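/- **Proposition.** Let $\mathbb C$ be a $\tau$-pretopos, that is, a pretopos (a Barr-exact, finitely extensive category with finite coproducts) in which every relation on an object has a transitive closure (a smallest transitive relation containing it). *Internal preorders.* Let $\mathsf{PreOrd}(\mathbb C)$ be the category of internal preorders $(A,\rho)$ in $\mathbb C$ ($\rho\rightarrowtail A\times A$ reflexive and transitive), with the morphisms of $\mathbb C$ that respect the relations. Let $\mathsf{Eq}(\mathbb C)$ and $\mathsf{ParOrd}(\mathbb C)$ be its full subcategories of equivalence relations and of partial orders ($\rho\cap\rho^{\circ}=\Delta_A$), and let $\mathcal Z=\mathsf{Eq}(\mathbb C)\cap\mathsf{ParOrd}(\mathbb C)$. A morphism is *trivial* if it factors through an object of $\mathcal Z$. A *$\mathcal Z$-kernel* of $f\colon A\to B$ is a morphism $k\colon K\to A$ such that $fk$ is trivial and every $l$ with $fl$ trivial factors uniquely through $k$; $\mathcal Z$-cokernels are defined dually, and $A\xrightarrow{f}B\xrightarrow{g}D$ is *short $\mathcal Z$-exact* if $f$ is a $\mathcal Z$-kernel of $g$ and $g$ is a $\mathcal Z$-cokernel of $f$. Two subobjects of an object are *complementary* if their intersection is the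 initial object $0$ and their union is the whole object; a subobject is *complemented* if it has a complement. *The stable category.* A partial morphism $A\rightharpoonup B$ of internal preorders is a pair $(\alpha,f)$ of a complemented subobject $\alpha\colon A'\rightarrowtail A$ in $\mathsf{PreOrd}(\mathbb C)$ and a morphism $f\colon A'\to B$, where pairs that differ by an isomorphism of the domains $A'$ are identified; partial morphisms are composed by pullback. Two partial morphisms $(\alpha_1,f_1),(\alpha_2,f_2)\colon A\rightharpoonup B$, with domains $A_1,A_2$, are equivalent if there are an object $A_0$ and complemented subobjects $\alpha_0^i\colon A_0\rightarrowtail A_i$ ($i=1,2$) such that $\alpha_1\alpha_0^1=\alpha_2\alpha_0^2$ is a complemented subobject of $A$, $f_1\alpha_0^1=f_2\alpha_0^2$, and each $f_i$ is trivial on the complement of $A_0$ in $A_i$. The *stable category* $\mathsf{Stab}(\mathbb C)$ is the quotient of the category of partial morphisms by this congruence; it is pointed. Let $\Sigma\colon\mathsf{PreOrd}(\mathbb C)\to\mathsf{Stab}(\mathbb C)$ be the canonical functor, which is the identity on objects and sends $f$ to the class of $(1,f)$. *The target.* Let $\mathbb X$ be a pointed category with finite coproducts and with a torsion theory $(\mathcal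 T,\mathcal F)$ (full replete subcategories such that every morphism from an object of $\mathcal T$ to an object of $\mathcal F$ is zero, and every object $X$ has a short exact sequence $0\to T\to X\to F\to 0$ with $T\in\mathcal T$, $F\in\mathcal F$). Assume that the coproducts of $\mathbb X$ are disjoint (the coprojections of $A\amalg B$ are monomorphisms whose intersection is initial) and pre-universal: for each $f\colon W\to A\amalg B$ there are a coproduct decomposition $W=A'\amalg B'$ and morphisms $A'\to A$, $B'\to B$ that commute with $f$ and the coprojections. *The functor.* Let $G\colon\mathsf{PreOrd}(\mathbb C)\to\mathbb X$ be a functor such that 1. $G$ preserves finite coproducts; 2. $G$ is a torsion theory functor: it sends $\mathsf{Eq}(\mathbb C)$ into $\mathcal T$ and $\mathsf{ParOrd}(\mathbb C)$ into $\mathcal F$, and it sends each short $\mathcal Z$-exact sequence $T\to A\to F$ with $T\in\mathsf{Eq}(\mathbb C)$ and $F\in\mathsf{ParOrd}(\mathbb C)$ to a short exact sequence $0\to G(T)\to G(A)\to G(F)\to 0$; 3. $G$ sends $\mathcal Z$-kernels to kernels. Then there is a unique functor $\overline G\colon\mathsf{Stab}(\mathbb C)\to\mathbb X$ with $\overline G\circ\Sigma=G$,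 and $\overline G$ preserves kernels: if $k$ is a kernel of $f$ in $\mathsf{Stab}(\mathbb C)$, then $\overline G(k)$ is a kernel of $\overline G(f)$ in $\mathbb X$. -/

import Mathlib

open CategoryTheory CategoryTheory.Limits

universe v u v' u'

namespace PreordStab

/-! ### Ideals of trivial morphisms, kernels, torsion theories -/

section General

variable {A : Type u} [Category.{v} A]

/-- A morphism is `Z`-trivial if it factors through an object of `Z`. -/
def IsTrivialMor (Z : ObjectProperty A) {X Y : A} (f : X ⟶ Y) : Prop :=
  ∃ (W : A) (g : X ⟶ W) (h : W ⟶ Y), Z W ∧ g ≫ h = f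

/-- `k` is a `Z`-kernel of `f`. -/
structure IsZKernel (Z : ObjectProperty A) {K X Y : A} (k : K ⟶ X) (f : X ⟶ Y) : Prop where
  trivial : IsTrivialMor Z (k ≫ f)
  existsUnique : ∀ {W : A} (l : W ⟶ X), IsTrivialMor Z (l ≫ f) → ∃! m : W ⟶ K, m ≫ k = l

/-- `q` is a `Z`-cokernel of `f`. -/
structure IsZCokernel (Z : ObjectProperty A) {X Y Q : A} (q : Y ⟶ Q) (f : X ⟶ Y) : Prop where
  trivial : IsTrivialMor Z (f ≫ q)
  existsUnique : ∀ {W : A} (l : Y ⟶ W), IsTrivialMor Z (f ≫ l) → ∃! m : Q ⟶ W, q ≫ m = l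

/-- `X ⟶ Y ⟶ W` is a short `Z`-exact sequence. -/
def IsShortZExact (Z : ObjectProperty A) {X Y W : A} (f : X ⟶ Y) (g : Y ⟶ W) : Prop :=
  IsZKernel Z f g ∧ IsZCokernel Z g f

/-- `k` is a kernel of `f`, in a category with zero morphisms. -/
def IsKernelOf [HasZeroMorphisms A] {K X Y : A} (k : K ⟶ X) (f : X ⟶ Y) : Prop :=
  ∃ w : k ≫ f = 0, Nonempty (IsLimit (KernelFork.ofι k w))

/-- `q` is a cokernel of `f`, in a category with zero morphisms. -/
def IsCokernelOf [HasZeroMorphisms A] {X Y Q : A} (q : Y ⟶ Q) (f : X ⟶ Y) : Prop :=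
  ∃ w : f ≫ q = 0, Nonempty (IsColimit (CokernelCofork.ofπ q w))

/-- `0 ⟶ X ⟶ Y ⟶ W ⟶ 0` is a short exact sequence, in a category with zero morphisms. -/
def IsShortExact [HasZeroMorphisms A] {X Y W : A} (f : X ⟶ Y) (g : Y ⟶ W) : Prop :=
  IsKernelOf f g ∧ IsCokernelOf g f

/-- A (classical) torsion theory in a pointed category: a pair of full replete subcategories. -/
structure IsTorsionTheory [HasZeroMorphisms A] (T F : ObjectProperty A) : Prop where
  replete_left : T.IsClosedUnderIsomorphisms
  replete_right : F.IsClosedUnderIsomorphisms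
  hom_eq_zero : ∀ {X Y : A} (f : X ⟶ Y), T X → F Y → f = 0
  exists_shortExact : ∀ X : A, ∃ (X₁ X₂ : A) (f : X₁ ⟶ X) (g : X ⟶ X₂),
    T X₁ ∧ F X₂ ∧ IsShortExact f g

/-- `a : X ⟶ B` and `b : Y ⟶ B` are complementary subobjects of `B`: their intersection is the
initial object, and the largest subobject of `B` is the only one containing both. -/
structure IsComplement {X Y B : A} (a : X ⟶ B) (b : Y ⟶ B) : Prop where
  mono_left : Mono a
  mono_right : Mono b
  inter : ∃ (P : A) (p : P ⟶ X) (q : P ⟶ Y), IsPullback p q a b ∧ Nonempty (IsInitial P)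
  union : ∀ {M : A} (m : M ⟶ B), Mono m → (∃ x, x ≫ m = a) → (∃ y, y ≫ m = b) → IsIso m

/-- Complemented subobjects. -/
def IsComplemented {X B : A} (a : X ⟶ B) : Prop :=
  ∃ (Y : A) (b : Y ⟶ B), IsComplement a b

/-- The binary coproducts of `A` are pre-universal. -/
def PreUniversalBinaryCoproducts (A : Type u) [Category.{v} A] [HasBinaryCoproducts A] : Prop :=
  ∀ {X Y W : A} (f : W ⟶ X ⨿ Y), ∃ (X' Y' : A) (s : X' ⟶ W) (t : Y' ⟶ W) (f₁ : X' ⟶ X)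
    (f₂ : Y' ⟶ Y), Nonempty (IsColimit (BinaryCofan.mk s t)) ∧
      s ≫ f = f₁ ≫ coprod.inl ∧ t ≫ f = f₂ ≫ coprod.inr

end General

/-- A torsion theory functor, from a category with a pretorsion theory `(T, F)` to a pointed
category with a torsion theory `(T', F')`. The canonical short exact sequence of an object is the
unique one, up to isomorphism, with its ends in `T` and `F`. -/
structure IsTorsionTheoryFunctor {A : Type u} [Category.{v} A] (T F : ObjectProperty A)
    {B : Type u'} [Category.{v'} B] [HasZeroMorphisms B] (T' F' : ObjectProperty B)
    (G : A ⥤ B) : Prop where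
  map_left : ∀ X : A, T X → T' (G.obj X)
  map_right : ∀ X : A, F X → F' (G.obj X)
  map_shortExact : ∀ {X Y W : A} (f : X ⟶ Y) (g : Y ⟶ W), T X → F W →
    IsShortZExact (T ⊓ F) f g → IsShortExact (G.map f) (G.map g)

/-- `G` sends `Z`-kernels to kernels. -/
def SendsZKernelsToKernels {A : Type u} [Category.{v} A] (Z : ObjectProperty A)
    {B : Type u'} [Category.{v'} B] [HasZeroMorphisms B] (G : A ⥤ B) : Prop :=
  ∀ {K X Y : A} (k : K ⟶ X) (f : X ⟶ Y), IsZKernel Z k f → IsKernelOf (G.map k) (G.map f)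

/-- `H` preserves kernels. -/
def PreservesKernels {A : Type u} [Category.{v} A] [HasZeroMorphisms A]
    {B : Type u'} [Category.{v'} B] [HasZeroMorphisms B] (H : A ⥤ B) : Prop :=
  ∀ {K X Y : A} (k : K ⟶ X) (f : X ⟶ Y), IsKernelOf k f → IsKernelOf (H.map k) (H.map f)

/-! ### Pretoposes -/

/-- A pretopos: a Barr-exact category which is (finitary) extensive. -/
class Pretopos (C : Type u) [Category.{v} C] : Prop extends Regular C, FinitaryExtensive C where
  exact : ∀ {R X : C} (p₁ p₂ : R ⟶ X), IsEquivalenceRelation p₁ p₂ →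
    ∃ (Q : C) (q : X ⟶ Q), IsKernelPair q p₁ p₂

/-- Inclusion of relations on `X`. -/
def RelLE {C : Type u} [Category.{v} C] {R S X : C} (r₁ r₂ : R ⟶ X) (s₁ s₂ : S ⟶ X) : Prop :=
  ∃ i : R ⟶ S, i ≫ s₁ = r₁ ∧ i ≫ s₂ = r₂

/-- `(t₁, t₂)` is the transitive closure of the relation `(r₁, r₂)`: the smallest transitive
relation that contains it. -/
structure IsTransitiveClosure {C : Type u} [Category.{v} C] {R T X : C} (r₁ r₂ : R ⟶ X)
    (t₁ t₂ : T ⟶ X) : Prop where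
  transitive : Nonempty (TransitiveRelation t₁ t₂)
  le : RelLE r₁ r₂ t₁ t₂
  min : ∀ {S : C} (s₁ s₂ : S ⟶ X), Nonempty (TransitiveRelation s₁ s₂) →
    RelLE r₁ r₂ s₁ s₂ → RelLE t₁ t₂ s₁ s₂

/-- A `τ`-pretopos: a pretopos in which every relation on an object has a transitive closure. -/
class TauPretopos (C : Type u) [Category.{v} C] : Prop extends Pretopos C where
  exists_transitiveClosure : ∀ {R X : C} (r₁ r₂ : R ⟶ X), JointlyMono₂ r₁ r₂ →
    ∃ (T : C) (t₁ t₂ : T ⟶ X), IsTransitiveClosure r₁ r₂ t₁ t₂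

/-! ### Internal preorders -/

/-- Internal preorders in `C`. -/
structure IntPreord (C : Type u) [Category.{v} C] where
  /-- the underlying object -/
  carrier : C
  /-- the object of related pairs -/
  rel : C
  /-- the first projection -/
  r₁ : rel ⟶ carrier
  /-- the second projection -/
  r₂ : rel ⟶ carrier
  jointlyMono : JointlyMono₂ r₁ r₂
  refl : Nonempty (ReflexiveRelation r₁ r₂)
  trans : Nonempty (TransitiveRelation r₁ r₂)

namespace IntPreord

/-- Morphisms of internal preorders. -/
@[ext]
structure Hom {C : Type u} [Category.{v} C] (X Y : IntPreord C) where
  /-- the morphism between the underlying objects -/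
  base : X.carrier ⟶ Y.carrier
  /-- the morphism between the relations -/
  onRel : X.rel ⟶ Y.rel
  comm₁ : X.r₁ ≫ base = onRel ≫ Y.r₁
  comm₂ : X.r₂ ≫ base = onRel ≫ Y.r₂

section

variable {C : Type u} [Category.{v} C]

instance instCategory : Category (IntPreord C) where
  Hom X Y := Hom X Y
  id X := ⟨𝟙 _, 𝟙 _, by simp, by simp⟩
  comp f g := ⟨f.base ≫ g.base, f.onRel ≫ g.onRel,
    by rw [← Category.assoc, f.comm₁, Category.assoc, g.comm₁, Category.assoc],
    by rw [← Category.assoc, f.comm₂, Category.assoc, g.comm₂, Category.assoc]⟩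
  id_comp f := Hom.ext (Category.id_comp _) (Category.id_comp _)
  comp_id f := Hom.ext (Category.comp_id _) (Category.comp_id _)
  assoc f g h := Hom.ext (Category.assoc _ _ _) (Category.assoc _ _ _)

@[simp]
theorem id_base (X : IntPreord C) : Hom.base (𝟙 X) = 𝟙 X.carrier := rfl

@[simp]
theorem id_onRel (X : IntPreord C) : Hom.onRel (𝟙 X) = 𝟙 X.rel := rfl

@[simp]
theorem comp_base {X Y Z : IntPreord C} (f : X ⟶ Y) (g : Y ⟶ Z) :
    Hom.base (f ≫ g) = Hom.base f ≫ Hom.base g := rfl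

@[simp]
theorem comp_onRel {X Y Z : IntPreord C} (f : X ⟶ Y) (g : Y ⟶ Z) :
    Hom.onRel (f ≫ g) = Hom.onRel f ≫ Hom.onRel g := rfl

theorem hom_ext {X Y : IntPreord C} {f g : X ⟶ Y} (h : Hom.base f = Hom.base g) : f = g := by
  have h' : Hom.onRel f = Hom.onRel g := by
    apply Y.jointlyMono.right_cancellation
    · rw [← Hom.comm₁, ← Hom.comm₁, h]
    · rw [← Hom.comm₂, ← Hom.comm₂, h]
  exact Hom.ext h h'

end

/-- The internal preorders that are equivalence relations. -/
def eqRel (C : Type u) [Category.{v} C] : ObjectProperty (IntPreord C) :=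
  fun X => ∃ s : X.rel ⟶ X.rel, s ≫ X.r₁ = X.r₂ ∧ s ≫ X.r₂ = X.r₁

/-- The internal preorders that are partial orders: any generalized element of the intersection of
the relation with its opposite lies on the diagonal. -/
def parOrd (C : Type u) [Category.{v} C] : ObjectProperty (IntPreord C) :=
  fun X => ∀ {W : C} (s t : W ⟶ X.rel), s ≫ X.r₁ = t ≫ X.r₂ → s ≫ X.r₂ = t ≫ X.r₁ →
    s ≫ X.r₁ = s ≫ X.r₂

/-- The trivial objects. -/
abbrev trivialObj (C : Type u) [Category.{v} C] : ObjectProperty (IntPreord C) :=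
  eqRel C ⊓ parOrd C

end IntPreord

/-! ### Binary coproduct decompositions in a pretopos -/

section Coproducts

variable {C : Type u} [Category.{v} C]

/-- `a` and `b` are the coprojections of a coproduct. -/
def IsCop {X Y W : C} (a : X ⟶ W) (b : Y ⟶ W) : Prop :=
  Nonempty (IsColimit (BinaryCofan.mk a b))

theorem IsCop.hom_ext {X Y W : C} {a : X ⟶ W} {b : Y ⟶ W} (h : IsCop a b) {Z : C} {f g : W ⟶ Z}
    (h₁ : a ≫ f = a ≫ g) (h₂ : b ≫ f = b ≫ g) : f = g := by
  obtain ⟨h⟩ := h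
  exact BinaryCofan.IsColimit.hom_ext h h₁ h₂

theorem IsCop.desc {X Y W : C} {a : X ⟶ W} {b : Y ⟶ W} (h : IsCop a b) {Z : C} (f : X ⟶ Z)
    (g : Y ⟶ Z) : ∃ d : W ⟶ Z, a ≫ d = f ∧ b ≫ d = g := by
  obtain ⟨h⟩ := h
  exact ⟨BinaryCofan.IsColimit.desc h f g, BinaryCofan.IsColimit.inl_desc h f g,
    BinaryCofan.IsColimit.inr_desc h f g⟩

theorem IsCop.of_desc {X Y W : C} {a : X ⟶ W} {b : Y ⟶ W}
    (hd : ∀ {Z : C} (f : X ⟶ Z) (g : Y ⟶ Z), ∃ d : W ⟶ Z, a ≫ d = f ∧ b ≫ d = g)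
    (he : ∀ {Z : C} (f g : W ⟶ Z), a ≫ f = a ≫ g → b ≫ f = b ≫ g → f = g) : IsCop a b := by
  choose d h₁ h₂ using @hd
  exact ⟨BinaryCofan.isColimitMk (fun s => d s.inl s.inr) (fun s => h₁ _ _) (fun s => h₂ _ _)
    (fun s m e₁ e₂ => he _ _ (e₁.trans (h₁ _ _).symm) (e₂.trans (h₂ _ _).symm))⟩

theorem isCop_coprod [HasBinaryCoproducts C] (X Y : C) :
    IsCop (coprod.inl : X ⟶ X ⨿ Y) coprod.inr :=
  ⟨coprodIsCoprod X Y⟩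

theorem IsCop.symm {X Y W : C} {a : X ⟶ W} {b : Y ⟶ W} (h : IsCop a b) : IsCop b a :=
  IsCop.of_desc (fun f g => (h.desc g f).imp fun _ hd => hd.symm)
    (fun _ _ h₁ h₂ => h.hom_ext h₂ h₁)

theorem IsCop.comp_iso {X Y W V : C} {a : X ⟶ W} {b : Y ⟶ W} (h : IsCop a b) (e : W ⟶ V)
    [IsIso e] : IsCop (a ≫ e) (b ≫ e) :=
  IsCop.of_desc
    (fun f g => by
      obtain ⟨d, h₁, h₂⟩ := h.desc f g
      exact ⟨inv e ≫ d, by simpa using h₁, by simpa using h₂⟩)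
    (fun f g h₁ h₂ => by
      have : e ≫ f = e ≫ g := h.hom_ext (by simpa using h₁) (by simpa using h₂)
      exact (cancel_epi e).1 this)

/-- Associativity of binary coproducts. -/
theorem IsCop.assoc {X Y U V W : C} {a : X ⟶ W} {b : Y ⟶ W} (h : IsCop a b)
    {c : U ⟶ X} {d : V ⟶ X} (h' : IsCop c d) {Z : C} {i : V ⟶ Z} {j : Y ⟶ Z} (hZ : IsCop i j)
    {k : Z ⟶ W} (hi : i ≫ k = d ≫ a) (hj : j ≫ k = b) : IsCop (c ≫ a) k := by
  refine IsCop.of_desc (fun f g => ?_) (fun f g h₁ h₂ => ?_)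
  · obtain ⟨e, he₁, he₂⟩ := h'.desc f (i ≫ g)
    obtain ⟨e', he₁', he₂'⟩ := h.desc e (j ≫ g)
    refine ⟨e', by rw [Category.assoc, he₁', he₁], hZ.hom_ext ?_ ?_⟩
    · rw [← Category.assoc, hi, Category.assoc, he₁', he₂]
    · rw [← Category.assoc, hj, he₂']
  · refine h.hom_ext (h'.hom_ext (by simpa using h₁) ?_) ?_
    · rw [← Category.assoc, ← hi, ← Category.assoc, ← hi, Category.assoc, h₂, Category.assoc]
    · rw [← hj, Category.assoc, h₂, Category.assoc]

section

variable [FinitaryExtensive C]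

theorem IsCop.isPullback {X Y W X' Y' W' : C} {a : X ⟶ W} {b : Y ⟶ W} (h : IsCop a b)
    {a' : X' ⟶ W'} {b' : Y' ⟶ W'} (h' : IsCop a' b') {x : X' ⟶ X} {y : Y' ⟶ Y} {f : W' ⟶ W}
    (hx : x ≫ a = a' ≫ f) (hy : y ≫ b = b' ≫ f) :
    IsPullback a' x f a ∧ IsPullback b' y f b := by
  obtain ⟨hc⟩ := h
  exact ((BinaryCofan.isVanKampen_iff _).1 (FinitaryExtensive.vanKampen _ hc)
    (BinaryCofan.mk a' b') x y f hx hy).1 h'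

theorem IsCop.of_isPullback {X Y W X' Y' W' : C} {a : X ⟶ W} {b : Y ⟶ W} (h : IsCop a b)
    {a' : X' ⟶ W'} {b' : Y' ⟶ W'} {x : X' ⟶ X} {y : Y' ⟶ Y} {f : W' ⟶ W}
    (hx : IsPullback a' x f a) (hy : IsPullback b' y f b) : IsCop a' b' := by
  obtain ⟨hc⟩ := h
  exact ((BinaryCofan.isVanKampen_iff _).1 (FinitaryExtensive.vanKampen _ hc)
    (BinaryCofan.mk a' b') x y f hx.w.symm hy.w.symm).2 ⟨hx, hy⟩

theorem IsCop.mono_left {X Y W : C} {a : X ⟶ W} {b : Y ⟶ W} (h : IsCop a b) : Mono a := by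
  obtain ⟨hc⟩ := h
  exact FinitaryExtensive.mono_inl_of_isColimit hc

theorem IsCop.mono_right {X Y W : C} {a : X ⟶ W} {b : Y ⟶ W} (h : IsCop a b) : Mono b :=
  h.symm.mono_left

/-- Any generalized element of a coproduct decomposes. -/
theorem IsCop.split [HasPullbacks C] {X Y W : C} {a : X ⟶ W} {b : Y ⟶ W} (h : IsCop a b) {V : C}
    (f : V ⟶ W) : ∃ (V₁ V₂ : C) (i : V₁ ⟶ V) (j : V₂ ⟶ V) (f₁ : V₁ ⟶ X) (f₂ : V₂ ⟶ Y),
      IsCop i j ∧ i ≫ f = f₁ ≫ a ∧ j ≫ f = f₂ ≫ b :=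
  ⟨_, _, pullback.fst f a, pullback.fst f b, pullback.snd f a, pullback.snd f b,
    h.of_isPullback (IsPullback.of_hasPullback f a) (IsPullback.of_hasPullback f b),
    pullback.condition, pullback.condition⟩

/-- The two parts of a coproduct are disjoint. -/
theorem IsCop.isInitial [HasPullbacks C] {X Y W : C} {a : X ⟶ W} {b : Y ⟶ W} (h : IsCop a b)
    {V : C} (f : V ⟶ X) (g : V ⟶ Y) (w : f ≫ a = g ≫ b) : Nonempty (IsInitial V) := by
  obtain ⟨hc⟩ := h
  have hp := FinitaryExtensive.isPullback_initial_to_binaryCofan hc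
  exact ⟨initialIsInitial.ofStrict (hp.lift f g w)⟩

end

end Coproducts

namespace IntPreord

section

variable {C : Type u} [Category.{v} C]

theorem refl_gen (X : IntPreord C) : ∃ r : X.carrier ⟶ X.rel, r ≫ X.r₁ = 𝟙 _ ∧ r ≫ X.r₂ = 𝟙 _ := by
  obtain ⟨h⟩ := X.refl
  exact ⟨h.r, h.reflexivity₁, h.reflexivity₂⟩

theorem trans_gen (X : IntPreord C) {W : C} (s t : W ⟶ X.rel) (h : s ≫ X.r₂ = t ≫ X.r₁) :
    ∃ w : W ⟶ X.rel, w ≫ X.r₁ = s ≫ X.r₁ ∧ w ≫ X.r₂ = t ≫ X.r₂ := by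
  obtain ⟨h'⟩ := X.trans
  refine ⟨PullbackCone.IsLimit.lift h'.isLimit s t h ≫ h'.t, ?_, ?_⟩
  · rw [Category.assoc, h'.transitivity₁, ← Category.assoc, PullbackCone.IsLimit.lift_fst]
  · rw [Category.assoc, h'.transitivity₂, ← Category.assoc, PullbackCone.IsLimit.lift_snd]

/-- Internal preorders through generalized elements. -/
def ofGen [HasPullbacks C] {R X : C} (r₁ r₂ : R ⟶ X) (hm : JointlyMono₂ r₁ r₂)
    (hr : ∃ r : X ⟶ R, r ≫ r₁ = 𝟙 _ ∧ r ≫ r₂ = 𝟙 _)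
    (ht : ∀ {W : C} (s t : W ⟶ R), s ≫ r₂ = t ≫ r₁ →
      ∃ w : W ⟶ R, w ≫ r₁ = s ≫ r₁ ∧ w ≫ r₂ = t ≫ r₂) : IntPreord C where
  carrier := X
  rel := R
  r₁ := r₁
  r₂ := r₂
  jointlyMono := hm
  refl := by
    obtain ⟨r, h₁, h₂⟩ := hr
    exact ⟨{ toJointlyMono₂ := hm, r := r, reflexivity₁ := h₁, reflexivity₂ := h₂ }⟩
  trans := by
    obtain ⟨w, h₁, h₂⟩ := ht (pullback.fst r₂ r₁) (pullback.snd r₂ r₁) pullback.condition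
    exact ⟨{ toJointlyMono₂ := hm, c := pullback.cone r₂ r₁, isLimit := pullback.isLimit r₂ r₁,
             t := w, transitivity₁ := h₁, transitivity₂ := h₂ }⟩

theorem mono_of_base {X Y : IntPreord C} (f : X ⟶ Y) (h : Mono (Hom.base f)) : Mono f :=
  ⟨fun _ _ e => hom_ext ((cancel_mono (Hom.base f)).1 (congrArg Hom.base e))⟩

variable [HasPullbacks C]

/-- The discrete preorder. -/
def discrete (X : C) : IntPreord C :=
  ofGen (𝟙 X) (𝟙 X) ⟨fun _ f g h _ => by simpa using h⟩ ⟨𝟙 X, by simp⟩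
    (fun s t h => ⟨s, rfl, h⟩)

/-- Morphisms out of a discrete preorder. -/
theorem exists_discrete_hom {X : C} {Y : IntPreord C} (f : X ⟶ Y.carrier) :
    ∃ g : discrete X ⟶ Y, Hom.base g = f := by
  obtain ⟨r, h₁, h₂⟩ := Y.refl_gen
  refine ⟨⟨f, f ≫ r, ?_, ?_⟩, rfl⟩
  · change 𝟙 X ≫ f = (f ≫ r) ≫ Y.r₁
    rw [Category.assoc, h₁, Category.comp_id, Category.id_comp]
  · change 𝟙 X ≫ f = (f ≫ r) ≫ Y.r₂
    rw [Category.assoc, h₂, Category.comp_id, Category.id_comp]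

theorem base_mono {X Y : IntPreord C} (f : X ⟶ Y) [Mono f] : Mono (Hom.base f) :=
  ⟨fun {Z} a b e => by
    obtain ⟨a', rfl⟩ := exists_discrete_hom a
    obtain ⟨b', rfl⟩ := exists_discrete_hom b
    have : a' = b' := (cancel_mono f).1 (hom_ext e)
    rw [this]⟩

theorem onRel_mono {X Y : IntPreord C} (f : X ⟶ Y) [Mono f] : Mono (Hom.onRel f) :=
  ⟨fun a b e => by
    have := base_mono f
    apply X.jointlyMono.right_cancellation
    · rw [← cancel_mono (Hom.base f), Category.assoc, Category.assoc, Hom.comm₁,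
        ← Category.assoc, e, Category.assoc]
    · rw [← cancel_mono (Hom.base f), Category.assoc, Category.assoc, Hom.comm₂,
        ← Category.assoc, e, Category.assoc]⟩

/-- The first projection of the relation of a pullback. -/
noncomputable def pbR₁ {X Y Z : IntPreord C} (f : X ⟶ Z) (g : Y ⟶ Z) :
    pullback (Hom.onRel f) (Hom.onRel g) ⟶ pullback (Hom.base f) (Hom.base g) :=
  pullback.lift (pullback.fst _ _ ≫ X.r₁) (pullback.snd _ _ ≫ Y.r₁) (by
    rw [Category.assoc, Category.assoc, Hom.comm₁, Hom.comm₁, pullback.condition_assoc])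

/-- The second projection of the relation of a pullback. -/
noncomputable def pbR₂ {X Y Z : IntPreord C} (f : X ⟶ Z) (g : Y ⟶ Z) :
    pullback (Hom.onRel f) (Hom.onRel g) ⟶ pullback (Hom.base f) (Hom.base g) :=
  pullback.lift (pullback.fst _ _ ≫ X.r₂) (pullback.snd _ _ ≫ Y.r₂) (by
    rw [Category.assoc, Category.assoc, Hom.comm₂, Hom.comm₂, pullback.condition_assoc])

@[simp]
theorem pbR₁_fst {X Y Z : IntPreord C} (f : X ⟶ Z) (g : Y ⟶ Z) :
    pbR₁ f g ≫ pullback.fst _ _ = pullback.fst _ _ ≫ X.r₁ := pullback.lift_fst _ _ _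

@[simp]
theorem pbR₁_snd {X Y Z : IntPreord C} (f : X ⟶ Z) (g : Y ⟶ Z) :
    pbR₁ f g ≫ pullback.snd _ _ = pullback.snd _ _ ≫ Y.r₁ := pullback.lift_snd _ _ _

@[simp]
theorem pbR₂_fst {X Y Z : IntPreord C} (f : X ⟶ Z) (g : Y ⟶ Z) :
    pbR₂ f g ≫ pullback.fst _ _ = pullback.fst _ _ ≫ X.r₂ := pullback.lift_fst _ _ _

@[simp]
theorem pbR₂_snd {X Y Z : IntPreord C} (f : X ⟶ Z) (g : Y ⟶ Z) :
    pbR₂ f g ≫ pullback.snd _ _ = pullback.snd _ _ ≫ Y.r₂ := pullback.lift_snd _ _ _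

/-- The pullback of internal preorders, computed componentwise. -/
noncomputable def pb {X Y Z : IntPreord C} (f : X ⟶ Z) (g : Y ⟶ Z) : IntPreord C :=
  ofGen (R := pullback (Hom.onRel f) (Hom.onRel g)) (X := pullback (Hom.base f) (Hom.base g))
    (pbR₁ f g) (pbR₂ f g)
    ⟨fun _ a b h₁ h₂ => by
      apply pullback.hom_ext
      · apply X.jointlyMono.right_cancellation
        · simpa using congrArg (fun t => t ≫ pullback.fst _ _) h₁
        · simpa using congrArg (fun t => t ≫ pullback.fst _ _) h₂
      · apply Y.jointlyMono.right_cancellation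
        · simpa using congrArg (fun t => t ≫ pullback.snd _ _) h₁
        · simpa using congrArg (fun t => t ≫ pullback.snd _ _) h₂⟩
    (by
      obtain ⟨r, h₁, h₂⟩ := X.refl_gen
      obtain ⟨s, k₁, k₂⟩ := Y.refl_gen
      refine ⟨pullback.lift (pullback.fst _ _ ≫ r) (pullback.snd _ _ ≫ s) ?_, ?_, ?_⟩
      · apply Z.jointlyMono.right_cancellation
        · simp only [Category.assoc, ← Hom.comm₁]
          rw [← Category.assoc r, h₁, ← Category.assoc s, k₁]
          simpa using pullback.condition
        · simp only [Category.assoc, ← Hom.comm₂]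
          rw [← Category.assoc r, h₂, ← Category.assoc s, k₂]
          simpa using pullback.condition
      · apply pullback.hom_ext <;> simp [h₁, k₁, pullback.lift_fst_assoc, pullback.lift_snd_assoc]
      · apply pullback.hom_ext <;> simp [h₂, k₂, pullback.lift_fst_assoc, pullback.lift_snd_assoc])
    (fun {W} s t h => by
      obtain ⟨w, h₁, h₂⟩ := X.trans_gen (s ≫ pullback.fst _ _) (t ≫ pullback.fst _ _)
        (by simpa using congrArg (fun t => t ≫ pullback.fst _ _) h)
      obtain ⟨w', h₁', h₂'⟩ := Y.trans_gen (s ≫ pullback.snd _ _) (t ≫ pullback.snd _ _)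
        (by simpa using congrArg (fun t => t ≫ pullback.snd _ _) h)
      refine ⟨pullback.lift w w' ?_, ?_, ?_⟩
      · apply Z.jointlyMono.right_cancellation
        · rw [Category.assoc, ← Hom.comm₁, ← Category.assoc, h₁, Category.assoc w', ← Hom.comm₁,
            ← Category.assoc w', h₁']
          simp only [Category.assoc, Hom.comm₁]
          rw [pullback.condition_assoc]
        · rw [Category.assoc, ← Hom.comm₂, ← Category.assoc, h₂, Category.assoc w', ← Hom.comm₂,
            ← Category.assoc w', h₂']
          simp only [Category.assoc, Hom.comm₂]
          rw [pullback.condition_assoc]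
      · apply pullback.hom_ext
        · simpa [pullback.lift_fst_assoc, pullback.lift_snd_assoc] using h₁
        · simpa [pullback.lift_fst_assoc, pullback.lift_snd_assoc] using h₁'
      · apply pullback.hom_ext
        · simpa [pullback.lift_fst_assoc, pullback.lift_snd_assoc] using h₂
        · simpa [pullback.lift_fst_assoc, pullback.lift_snd_assoc] using h₂')

/-- The first projection of the pullback. -/
noncomputable def pbFst {X Y Z : IntPreord C} (f : X ⟶ Z) (g : Y ⟶ Z) : pb f g ⟶ X :=
  Hom.mk (pullback.fst _ _) (pullback.fst _ _) (pbR₁_fst f g) (pbR₂_fst f g)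

/-- The second projection of the pullback. -/
noncomputable def pbSnd {X Y Z : IntPreord C} (f : X ⟶ Z) (g : Y ⟶ Z) : pb f g ⟶ Y :=
  Hom.mk (pullback.snd _ _) (pullback.snd _ _) (pbR₁_snd f g) (pbR₂_snd f g)

theorem isPullback_pb {X Y Z : IntPreord C} (f : X ⟶ Z) (g : Y ⟶ Z) :
    IsPullback (pbFst f g) (pbSnd f g) f g := by
  refine ⟨⟨hom_ext pullback.condition⟩, ⟨PullbackCone.IsLimit.mk _
    (fun s => Hom.mk
      (pullback.lift (Hom.base s.fst) (Hom.base s.snd) (congrArg Hom.base s.condition))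
      (pullback.lift (Hom.onRel s.fst) (Hom.onRel s.snd) (congrArg Hom.onRel s.condition))
      ?_ ?_) (fun s => ?_) (fun s => ?_) (fun s m h₁ h₂ => ?_)⟩⟩
  · apply pullback.hom_ext
    · simpa [pb, ofGen, pullback.lift_fst_assoc, pullback.lift_snd_assoc, pullback.lift_fst, pullback.lift_snd] using Hom.comm₁ s.fst
    · simpa [pb, ofGen, pullback.lift_fst_assoc, pullback.lift_snd_assoc, pullback.lift_fst, pullback.lift_snd] using Hom.comm₁ s.snd
  · apply pullback.hom_ext
    · simpa [pb, ofGen, pullback.lift_fst_assoc, pullback.lift_snd_assoc, pullback.lift_fst, pullback.lift_snd] using Hom.comm₂ s.fst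
    · simpa [pb, ofGen, pullback.lift_fst_assoc, pullback.lift_snd_assoc, pullback.lift_fst, pullback.lift_snd] using Hom.comm₂ s.snd
  · exact hom_ext (pullback.lift_fst _ _ _)
  · exact hom_ext (pullback.lift_snd _ _ _)
  · apply hom_ext
    apply pullback.hom_ext
    · exact (congrArg Hom.base h₁).trans (pullback.lift_fst _ _ _).symm
    · exact (congrArg Hom.base h₂).trans (pullback.lift_snd _ _ _).symm

end

end IntPreord

set_option linter.unusedSectionVars false

namespace IntPreord

section

variable {C : Type u} [Category.{v} C] [FinitaryExtensive C] [HasPullbacks C]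

theorem isInitial_of_carrier {X : IntPreord C} (h : IsInitial X.carrier) :
    Nonempty (IsInitial X) := by
  have h' : IsInitial X.rel := h.ofStrict X.r₁
  exact ⟨IsInitial.ofUniqueHom
    (fun Y => Hom.mk (h.to _) (h'.to _) (h'.hom_ext _ _) (h'.hom_ext _ _))
    (fun Y m => hom_ext (h.hom_ext _ _))⟩

variable (C) in
/-- The empty preorder. -/
noncomputable def empty : IntPreord C := discrete (⊥_ C)

theorem empty_isInitial : Nonempty (IsInitial (empty C)) :=
  isInitial_of_carrier (X := empty C) (initialIsInitial : IsInitial (⊥_ C))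

theorem carrier_isInitial {X : IntPreord C} (h : IsInitial X) : Nonempty (IsInitial X.carrier) :=
  ⟨IsInitial.ofStrict (X := X.carrier) (Y := ⊥_ C) (Hom.base (h.to (empty C))) initialIsInitial⟩

/-- The initial internal preorder is strict. -/
theorem isInitial_of_hom {X Y : IntPreord C} (f : X ⟶ Y) (h : IsInitial Y) :
    Nonempty (IsInitial X) := by
  obtain ⟨h'⟩ := carrier_isInitial h
  exact isInitial_of_carrier (h'.ofStrict (Hom.base f))

/-- A generalized element of a componentwise coproduct over the left component. -/
theorem exists_left {X Y W X' Y' W' : C} {a : X ⟶ W} {b : Y ⟶ W} (h : IsCop a b)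
    {a' : X' ⟶ W'} {b' : Y' ⟶ W'} (h' : IsCop a' b') {x : X' ⟶ X} {y : Y' ⟶ Y} {f : W' ⟶ W}
    (hx : x ≫ a = a' ≫ f) (hy : y ≫ b = b' ≫ f) {V : C} (t : V ⟶ W') (s : V ⟶ X)
    (hs : t ≫ f = s ≫ a) : ∃ l : V ⟶ X', l ≫ a' = t ∧ l ≫ x = s := by
  have hp := (h.isPullback h' hx hy).1
  exact ⟨hp.lift t s hs, hp.lift_fst _ _ _, hp.lift_snd _ _ _⟩

section Sum

variable {W R X₁ X₂ R₁ R₂ : C} {a₁ : X₁ ⟶ W} {a₂ : X₂ ⟶ W} {b₁ : R₁ ⟶ R} {b₂ : R₂ ⟶ R}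
  {p q : R ⟶ W} {p₁ q₁ : R₁ ⟶ X₁} {p₂ q₂ : R₂ ⟶ X₂}

theorem jointlyMono_of_cop (ha : IsCop a₁ a₂) (hb : IsCop b₁ b₂)
    (hp₁ : p₁ ≫ a₁ = b₁ ≫ p) (hp₂ : p₂ ≫ a₂ = b₂ ≫ p) (hq₁ : q₁ ≫ a₁ = b₁ ≫ q)
    (hq₂ : q₂ ≫ a₂ = b₂ ≫ q) (m₁ : JointlyMono₂ p₁ q₁) (m₂ : JointlyMono₂ p₂ q₂) :
    JointlyMono₂ p q := by
  refine ⟨fun V f g h₁ h₂ => ?_⟩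
  obtain ⟨V₁, V₂, i, j, f₁, f₂, hV, hi, hj⟩ := ha.split (f ≫ p)
  have := ha.mono_left
  have := ha.mono_right
  apply hV.hom_ext
  · obtain ⟨l, hl, hl'⟩ := exists_left ha hb hp₁ hp₂ (i ≫ f) f₁ (by simpa using hi)
    obtain ⟨l', hl₂, hl₂'⟩ := exists_left ha hb hp₁ hp₂ (i ≫ g) f₁ (by
      rw [Category.assoc, ← h₁, hi])
    rw [← hl, ← hl₂]
    congr 1
    refine m₁.right_cancellation _ _ (hl'.trans hl₂'.symm) ?_
    rw [← cancel_mono a₁, Category.assoc, hq₁, ← Category.assoc, hl, Category.assoc, h₂,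
      Category.assoc, hq₁, ← Category.assoc l', hl₂, Category.assoc]
  · obtain ⟨l, hl, hl'⟩ := exists_left ha.symm hb.symm hp₂ hp₁ (j ≫ f) f₂ (by simpa using hj)
    obtain ⟨l', hl₂, hl₂'⟩ := exists_left ha.symm hb.symm hp₂ hp₁ (j ≫ g) f₂ (by
      rw [Category.assoc, ← h₁, hj])
    rw [← hl, ← hl₂]
    congr 1
    refine m₂.right_cancellation _ _ (hl'.trans hl₂'.symm) ?_
    rw [← cancel_mono a₂, Category.assoc, hq₂, ← Category.assoc, hl, Category.assoc, h₂,
      Category.assoc, hq₂, ← Category.assoc l', hl₂, Category.assoc]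

theorem trans_of_cop (ha : IsCop a₁ a₂) (hb : IsCop b₁ b₂)
    (hp₁ : p₁ ≫ a₁ = b₁ ≫ p) (hp₂ : p₂ ≫ a₂ = b₂ ≫ p) (hq₁ : q₁ ≫ a₁ = b₁ ≫ q)
    (hq₂ : q₂ ≫ a₂ = b₂ ≫ q)
    (t₁ : ∀ {V : C} (s t : V ⟶ R₁), s ≫ q₁ = t ≫ p₁ →
      ∃ w : V ⟶ R₁, w ≫ p₁ = s ≫ p₁ ∧ w ≫ q₁ = t ≫ q₁)
    (t₂ : ∀ {V : C} (s t : V ⟶ R₂), s ≫ q₂ = t ≫ p₂ →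
      ∃ w : V ⟶ R₂, w ≫ p₂ = s ≫ p₂ ∧ w ≫ q₂ = t ≫ q₂)
    {V : C} (s t : V ⟶ R) (h : s ≫ q = t ≫ p) :
    ∃ w : V ⟶ R, w ≫ p = s ≫ p ∧ w ≫ q = t ≫ q := by
  obtain ⟨V₁, V₂, i, j, f₁, f₂, hV, hi, hj⟩ := ha.split (s ≫ q)
  obtain ⟨l, hl, hl'⟩ := exists_left ha hb hq₁ hq₂ (i ≫ s) f₁ (by simpa using hi)
  obtain ⟨m, hm, hm'⟩ := exists_left ha hb hp₁ hp₂ (i ≫ t) f₁ (by rw [Category.assoc, ← h, hi])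
  obtain ⟨l₂, hl₂, hl₂'⟩ := exists_left ha.symm hb.symm hq₂ hq₁ (j ≫ s) f₂ (by simpa using hj)
  obtain ⟨m₂, hm₂, hm₂'⟩ := exists_left ha.symm hb.symm hp₂ hp₁ (j ≫ t) f₂
    (by rw [Category.assoc, ← h, hj])
  obtain ⟨w₁, hw₁, hw₁'⟩ := t₁ l m (hl'.trans hm'.symm)
  obtain ⟨w₂, hw₂, hw₂'⟩ := t₂ l₂ m₂ (hl₂'.trans hm₂'.symm)
  obtain ⟨w, hw, hw'⟩ := hV.desc (w₁ ≫ b₁) (w₂ ≫ b₂)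
  refine ⟨w, hV.hom_ext ?_ ?_, hV.hom_ext ?_ ?_⟩
  · rw [← Category.assoc, hw, Category.assoc, ← hp₁, ← Category.assoc, hw₁, Category.assoc, hp₁,
      ← Category.assoc, hl, Category.assoc]
  · rw [← Category.assoc, hw', Category.assoc, ← hp₂, ← Category.assoc, hw₂, Category.assoc, hp₂,
      ← Category.assoc, hl₂, Category.assoc]
  · rw [← Category.assoc, hw, Category.assoc, ← hq₁, ← Category.assoc, hw₁', Category.assoc, hq₁,
      ← Category.assoc, hm, Category.assoc]
  · rw [← Category.assoc, hw', Category.assoc, ← hq₂, ← Category.assoc, hw₂', Category.assoc, hq₂,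
      ← Category.assoc, hm₂, Category.assoc]

end Sum

/-- Binary coproducts of internal preorders exist and are computed componentwise. -/
theorem exists_sum (X Y : IntPreord C) : ∃ (S : IntPreord C) (i : X ⟶ S) (j : Y ⟶ S),
    IsCop (Hom.base i) (Hom.base j) ∧ IsCop (Hom.onRel i) (Hom.onRel j) := by
  have ha := isCop_coprod X.carrier Y.carrier
  have hb := isCop_coprod X.rel Y.rel
  have hp₁ : X.r₁ ≫ coprod.inl = coprod.inl ≫ coprod.map X.r₁ Y.r₁ := (coprod.inl_map _ _).symm
  have hp₂ : Y.r₁ ≫ coprod.inr = coprod.inr ≫ coprod.map X.r₁ Y.r₁ := (coprod.inr_map _ _).symm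
  have hq₁ : X.r₂ ≫ coprod.inl = coprod.inl ≫ coprod.map X.r₂ Y.r₂ := (coprod.inl_map _ _).symm
  have hq₂ : Y.r₂ ≫ coprod.inr = coprod.inr ≫ coprod.map X.r₂ Y.r₂ := (coprod.inr_map _ _).symm
  refine ⟨ofGen (coprod.map X.r₁ Y.r₁) (coprod.map X.r₂ Y.r₂)
    (jointlyMono_of_cop ha hb hp₁ hp₂ hq₁ hq₂ X.jointlyMono Y.jointlyMono) ?_
    (trans_of_cop ha hb hp₁ hp₂ hq₁ hq₂ X.trans_gen Y.trans_gen),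
    Hom.mk coprod.inl coprod.inl hp₁ hq₁, Hom.mk coprod.inr coprod.inr hp₂ hq₂, ha, hb⟩
  obtain ⟨r, h₁, h₂⟩ := X.refl_gen
  obtain ⟨s, k₁, k₂⟩ := Y.refl_gen
  exact ⟨coprod.map r s, by rw [coprod.map_map, h₁, k₁, coprod.map_id_id],
    by rw [coprod.map_map, h₂, k₂, coprod.map_id_id]⟩

/-- A morphism out of a componentwise coproduct. -/
theorem exists_desc {X Y S Z : IntPreord C} {i : X ⟶ S} {j : Y ⟶ S}
    (hb : IsCop (Hom.base i) (Hom.base j)) (hr : IsCop (Hom.onRel i) (Hom.onRel j))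
    (f : X ⟶ Z) (g : Y ⟶ Z) : ∃ d : S ⟶ Z, i ≫ d = f ∧ j ≫ d = g := by
  obtain ⟨d, h₁, h₂⟩ := hb.desc (Hom.base f) (Hom.base g)
  obtain ⟨e, k₁, k₂⟩ := hr.desc (Hom.onRel f) (Hom.onRel g)
  refine ⟨Hom.mk d e (hr.hom_ext ?_ ?_) (hr.hom_ext ?_ ?_), hom_ext h₁, hom_ext h₂⟩
  · rw [← Category.assoc, ← Hom.comm₁, Category.assoc, h₁, ← Category.assoc, k₁, Hom.comm₁]
  · rw [← Category.assoc, ← Hom.comm₁, Category.assoc, h₂, ← Category.assoc, k₂, Hom.comm₁]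
  · rw [← Category.assoc, ← Hom.comm₂, Category.assoc, h₁, ← Category.assoc, k₁, Hom.comm₂]
  · rw [← Category.assoc, ← Hom.comm₂, Category.assoc, h₂, ← Category.assoc, k₂, Hom.comm₂]

/-- The morphism from a coproduct induced by two disjoint monomorphisms is a monomorphism. -/
theorem mono_of_disjoint {X Y W B : C} {i : X ⟶ W} {j : Y ⟶ W} (h : IsCop i j) (f : W ⟶ B)
    (hi : Mono (i ≫ f)) (hj : Mono (j ≫ f))
    (hd : ∀ {V : C} (s : V ⟶ X) (t : V ⟶ Y), s ≫ i ≫ f = t ≫ j ≫ f → Nonempty (IsInitial V)) :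
    Mono f := by
  refine ⟨fun {V} s t e => ?_⟩
  obtain ⟨V₁, V₂, a, b, s₁, s₂, hV, h₁, h₂⟩ := h.split s
  apply hV.hom_ext
  · obtain ⟨U₁, U₂, c, d, t₁, t₂, hU, k₁, k₂⟩ := h.split (a ≫ t)
    apply hU.hom_ext
    · have : c ≫ s₁ = t₁ := by
        rw [← cancel_mono (i ≫ f)]
        simp only [Category.assoc]
        rw [← Category.assoc s₁, ← h₁, ← Category.assoc t₁, ← k₁]
        simp [e]
      rw [h₁, k₁, ← this, Category.assoc]
    · obtain ⟨hI⟩ := hd (d ≫ s₁) t₂ (by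
        simp only [Category.assoc]
        rw [← Category.assoc s₁, ← h₁, ← Category.assoc t₂, ← k₂]
        simp [e])
      exact hI.hom_ext _ _
  · obtain ⟨U₁, U₂, c, d, t₁, t₂, hU, k₁, k₂⟩ := h.split (b ≫ t)
    apply hU.hom_ext
    · obtain ⟨hI⟩ := hd t₁ (c ≫ s₂) (by
        simp only [Category.assoc]
        rw [← Category.assoc s₂, ← h₂, ← Category.assoc t₁, ← k₁]
        simp [e])
      exact hI.hom_ext _ _
    · have : d ≫ s₂ = t₂ := by
        rw [← cancel_mono (j ≫ f)]
        simp only [Category.assoc]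
        rw [← Category.assoc s₂, ← h₂, ← Category.assoc t₂, ← k₂]
        simp [e]
      rw [h₂, k₂, ← this, Category.assoc]

/-- Complementary subobjects of an internal preorder are componentwise coproduct decompositions. -/
theorem isComplement_iff {X Y B : IntPreord C} (a : X ⟶ B) (b : Y ⟶ B) :
    IsComplement a b ↔
      IsCop (Hom.base a) (Hom.base b) ∧ IsCop (Hom.onRel a) (Hom.onRel b) := by
  constructor
  · intro h
    have := h.mono_left
    have := h.mono_right
    obtain ⟨S, i, j, hb, hr⟩ := exists_sum X Y
    obtain ⟨d, h₁, h₂⟩ := exists_desc hb hr a b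
    have hd : Mono (Hom.base d) := by
      have e₁ : Hom.base i ≫ Hom.base d = Hom.base a := congrArg Hom.base h₁
      have e₂ : Hom.base j ≫ Hom.base d = Hom.base b := congrArg Hom.base h₂
      refine mono_of_disjoint hb (Hom.base d) ?_ ?_ ?_
      · rw [e₁]; exact base_mono a
      · rw [e₂]; exact base_mono b
      · intro V s t e
        rw [e₁, e₂] at e
        obtain ⟨P, p, q, hP, ⟨hI⟩⟩ := h.inter
        obtain ⟨s', rfl⟩ := exists_discrete_hom s
        obtain ⟨t', rfl⟩ := exists_discrete_hom t
        obtain ⟨hI'⟩ := isInitial_of_hom (hP.lift s' t' (hom_ext e)) hI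
        exact carrier_isInitial hI'
    have := h.union d (mono_of_base d hd) ⟨i, h₁⟩ ⟨j, h₂⟩
    have i₁ : IsIso (Hom.base d) := ⟨Hom.base (inv d),
      congrArg Hom.base (IsIso.hom_inv_id d), congrArg Hom.base (IsIso.inv_hom_id d)⟩
    have i₂ : IsIso (Hom.onRel d) := ⟨Hom.onRel (inv d),
      congrArg Hom.onRel (IsIso.hom_inv_id d), congrArg Hom.onRel (IsIso.inv_hom_id d)⟩
    subst h₁ h₂
    exact ⟨hb.comp_iso _, hr.comp_iso _⟩
  · rintro ⟨hb, hr⟩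
    refine ⟨mono_of_base a hb.mono_left, mono_of_base b hb.mono_right, ?_, ?_⟩
    · refine ⟨pb a b, pbFst a b, pbSnd a b, isPullback_pb a b, ?_⟩
      obtain ⟨hI⟩ := hb.isInitial _ _ (congrArg Hom.base (isPullback_pb a b).w)
      exact isInitial_of_carrier hI
    · rintro M m hm ⟨x, rfl⟩ ⟨y, rfl⟩
      obtain ⟨d, h₁, h₂⟩ := exists_desc hb hr x y
      have : d ≫ m = 𝟙 B := hom_ext (hb.hom_ext
        (by simpa using congrArg (fun t => Hom.base (t ≫ m)) h₁)
        (by simpa using congrArg (fun t => Hom.base (t ≫ m)) h₂))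
      exact ⟨d, by rw [← cancel_mono m, Category.assoc, this, Category.comp_id, Category.id_comp],
        this⟩

theorem isPullback_base {P X Y Z : IntPreord C} {p : P ⟶ X} {q : P ⟶ Y} {f : X ⟶ Z} {g : Y ⟶ Z}
    (h : IsPullback p q f g) :
    IsPullback (Hom.base p) (Hom.base q) (Hom.base f) (Hom.base g) := by
  let e := h.isoIsPullback _ _ (isPullback_pb f g)
  have e₁ : e.hom ≫ pbFst f g = p := h.isoIsPullback_hom_fst _ _ _
  have e₂ : e.hom ≫ pbSnd f g = q := h.isoIsPullback_hom_snd _ _ _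
  refine IsPullback.of_iso (IsPullback.of_hasPullback (Hom.base f) (Hom.base g))
    (Iso.mk (Hom.base e.inv) (Hom.base e.hom) (congrArg Hom.base e.inv_hom_id)
      (congrArg Hom.base e.hom_inv_id)) (Iso.refl _) (Iso.refl _) (Iso.refl _) ?_ ?_ ?_ ?_
  · have : e.inv ≫ p = pbFst f g := by rw [← e₁, Iso.inv_hom_id_assoc]
    exact (Category.comp_id _).trans (congrArg Hom.base this).symm
  · have : e.inv ≫ q = pbSnd f g := by rw [← e₂, Iso.inv_hom_id_assoc]
    exact (Category.comp_id _).trans (congrArg Hom.base this).symm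
  · simp
  · simp

theorem isPullback_onRel {P X Y Z : IntPreord C} {p : P ⟶ X} {q : P ⟶ Y} {f : X ⟶ Z}
    {g : Y ⟶ Z} (h : IsPullback p q f g) :
    IsPullback (Hom.onRel p) (Hom.onRel q) (Hom.onRel f) (Hom.onRel g) := by
  let e := h.isoIsPullback _ _ (isPullback_pb f g)
  have e₁ : e.hom ≫ pbFst f g = p := h.isoIsPullback_hom_fst _ _ _
  have e₂ : e.hom ≫ pbSnd f g = q := h.isoIsPullback_hom_snd _ _ _
  refine IsPullback.of_iso (IsPullback.of_hasPullback (Hom.onRel f) (Hom.onRel g))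
    (Iso.mk (Hom.onRel e.inv) (Hom.onRel e.hom) (congrArg Hom.onRel e.inv_hom_id)
      (congrArg Hom.onRel e.hom_inv_id)) (Iso.refl _) (Iso.refl _) (Iso.refl _) ?_ ?_ ?_ ?_
  · have : e.inv ≫ p = pbFst f g := by rw [← e₁, Iso.inv_hom_id_assoc]
    exact (Category.comp_id _).trans (congrArg Hom.onRel this).symm
  · have : e.inv ≫ q = pbSnd f g := by rw [← e₂, Iso.inv_hom_id_assoc]
    exact (Category.comp_id _).trans (congrArg Hom.onRel this).symm
  · simp
  · simp

/-- Complemented subobjects are stable under pullback. -/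
theorem isComplemented_of_isPullback {P X Y Z : IntPreord C} {p : P ⟶ X} {q : P ⟶ Y} {f : X ⟶ Z}
    {g : Y ⟶ Z} (h : IsPullback p q f g) (hg : IsComplemented g) : IsComplemented p := by
  obtain ⟨Y', g', hg'⟩ := hg
  rw [isComplement_iff] at hg'
  have h' := isPullback_pb f g'
  exact ⟨_, _, (isComplement_iff _ _).2 ⟨hg'.1.of_isPullback (isPullback_base h)
    (isPullback_base h'), hg'.2.of_isPullback (isPullback_onRel h) (isPullback_onRel h')⟩⟩

theorem isComplemented_comp {X Y Z : IntPreord C} {f : X ⟶ Y} {g : Y ⟶ Z}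
    (hf : IsComplemented f) (hg : IsComplemented g) : IsComplemented (f ≫ g) := by
  obtain ⟨X', f', hf'⟩ := hf
  obtain ⟨Y', g', hg'⟩ := hg
  rw [isComplement_iff] at hf' hg'
  obtain ⟨S, i, j, hb, hr⟩ := exists_sum X' Y'
  obtain ⟨d, h₁, h₂⟩ := exists_desc hb hr (f' ≫ g) g'
  exact ⟨S, d, (isComplement_iff _ _).2
    ⟨hg'.1.assoc hf'.1 hb (congrArg Hom.base h₁) (congrArg Hom.base h₂),
      hg'.2.assoc hf'.2 hr (congrArg Hom.onRel h₁) (congrArg Hom.onRel h₂)⟩⟩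

theorem isComplement_id_empty {X E : IntPreord C} (e : E ⟶ X) (h : IsInitial E) :
    IsComplement (𝟙 X) e := by
  obtain ⟨h'⟩ := carrier_isInitial h
  have h'' : IsInitial E.rel := h'.ofStrict E.r₁
  refine (isComplement_iff _ _).2 ⟨IsCop.of_desc (fun f g => ⟨f, by simp, h'.hom_ext _ _⟩)
    (fun f g k _ => by simpa using k), IsCop.of_desc (fun f g => ⟨f, by simp, h''.hom_ext _ _⟩)
    (fun f g k _ => by simpa using k)⟩

theorem isComplemented_id (X : IntPreord C) : IsComplemented (𝟙 X) := by
  obtain ⟨h⟩ := empty_isInitial (C := C)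
  exact ⟨_, h.to X, isComplement_id_empty _ h⟩

theorem isComplement_symm {X Y B : IntPreord C} {a : X ⟶ B} {b : Y ⟶ B} (h : IsComplement a b) :
    IsComplement b a := by
  rw [isComplement_iff] at h ⊢
  exact ⟨h.1.symm, h.2.symm⟩

end

end IntPreord

/-! ### Partial morphisms and the stable category -/

section PartialMaps

variable {C : Type u} [Category.{v} C]

/-- A representative of a partial morphism `X ⇀ Y` of internal preorders: a morphism to `Y` that is
defined on a complemented subobject of `X`. -/
structure PMap (X Y : IntPreord C) where
  /-- the domain of definition -/
  dom : IntPreord C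
  /-- its inclusion -/
  incl : dom ⟶ X
  /-- the morphism on the domain of definition -/
  map : dom ⟶ Y
  complemented : IsComplemented incl

/-- Two representatives define the same partial morphism if they differ by an isomorphism of the
domains of definition. -/
def PMap.Same {X Y : IntPreord C} (x y : PMap X Y) : Prop :=
  ∃ e : x.dom ≅ y.dom, e.hom ≫ y.incl = x.incl ∧ e.hom ≫ y.map = x.map

instance PMap.setoid (X Y : IntPreord C) : Setoid (PMap X Y) where
  r := PMap.Same
  iseqv :=
    { refl := fun x => ⟨Iso.refl _, by simp, by simp⟩
      symm := fun ⟨e, h₁, h₂⟩ => ⟨e.symm, by simp [← h₁], by simp [← h₂]⟩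
      trans := fun ⟨e, h₁, h₂⟩ ⟨e', h₁', h₂'⟩ => ⟨e ≪≫ e', by simp [h₁, h₁'], by simp [h₂, h₂']⟩ }

variable [Pretopos C]

/-- The identity partial morphism. -/
def PMap.id (X : IntPreord C) : PMap X X :=
  ⟨X, 𝟙 X, 𝟙 X, IntPreord.isComplemented_id X⟩

/-- The partial morphism that is defined by a morphism of internal preorders. -/
def PMap.ofHom {X Y : IntPreord C} (f : X ⟶ Y) : PMap X Y :=
  ⟨X, 𝟙 X, f, IntPreord.isComplemented_id X⟩

/-- The composite of partial morphisms, through a given pullback. -/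
def PMap.compOf {X Y Z : IntPreord C} (x : PMap X Y) (y : PMap Y Z) {P : IntPreord C}
    {p : P ⟶ x.dom} {q : P ⟶ y.dom} (h : IsPullback p q x.map y.incl) : PMap X Z :=
  ⟨P, p ≫ x.incl, q ≫ y.map, IntPreord.isComplemented_comp
    (IntPreord.isComplemented_of_isPullback h y.complemented) x.complemented⟩

/-- The composite of partial morphisms. -/
noncomputable def PMap.comp {X Y Z : IntPreord C} (x : PMap X Y) (y : PMap Y Z) : PMap X Z :=
  x.compOf y (IntPreord.isPullback_pb x.map y.incl)

theorem PMap.compOf_same {X Y Z : IntPreord C} {x x' : PMap X Y} {y y' : PMap Y Z}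
    (hx : x.Same x') (hy : y.Same y') {P P' : IntPreord C}
    {p : P ⟶ x.dom} {q : P ⟶ y.dom} (h : IsPullback p q x.map y.incl)
    {p' : P' ⟶ x'.dom} {q' : P' ⟶ y'.dom} (h' : IsPullback p' q' x'.map y'.incl) :
    (x.compOf y h).Same (x'.compOf y' h') := by
  obtain ⟨e, e₁, e₂⟩ := hx
  obtain ⟨d, d₁, d₂⟩ := hy
  have h'' : IsPullback (p ≫ e.hom) (q ≫ d.hom) x'.map y'.incl :=
    IsPullback.of_iso h (Iso.refl _) e d (Iso.refl _) (by simp) (by simp) (by simp [e₂])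
      (by simp [d₁])
  have k₁ : (h''.isoIsPullback _ _ h').hom ≫ p' ≫ x'.incl = p ≫ x.incl := by
    rw [← Category.assoc, IsPullback.isoIsPullback_hom_fst, Category.assoc, e₁]
  have k₂ : (h''.isoIsPullback _ _ h').hom ≫ q' ≫ y'.map = q ≫ y.map := by
    rw [← Category.assoc, IsPullback.isoIsPullback_hom_snd, Category.assoc, d₂]
  exact ⟨h''.isoIsPullback _ _ h', k₁, k₂⟩

theorem PMap.same_refl {X Y : IntPreord C} (x : PMap X Y) : x.Same x :=
  (PMap.setoid X Y).iseqv.refl x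

theorem PMap.same_symm {X Y : IntPreord C} {x y : PMap X Y} (h : x.Same y) : y.Same x :=
  (PMap.setoid X Y).iseqv.symm h

theorem PMap.same_trans {X Y : IntPreord C} {x y z : PMap X Y} (h : x.Same y) (h' : y.Same z) :
    x.Same z :=
  (PMap.setoid X Y).iseqv.trans h h'

theorem PMap.id_comp_same {X Y : IntPreord C} (x : PMap X Y) : ((PMap.id X).comp x).Same x := by
  have h : IsPullback x.incl (𝟙 x.dom) (PMap.id X).map x.incl := by
    change IsPullback x.incl (𝟙 x.dom) (𝟙 X) x.incl
    exact IsPullback.of_vert_isIso ⟨by simp⟩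
  refine PMap.same_trans (PMap.compOf_same (PMap.same_refl _) (PMap.same_refl _) _ h) ?_
  refine ⟨Iso.refl _, ?_, ?_⟩
  · change 𝟙 _ ≫ x.incl = x.incl ≫ 𝟙 _
    simp
  · change 𝟙 _ ≫ x.map = 𝟙 _ ≫ x.map
    simp

theorem PMap.comp_id_same {X Y : IntPreord C} (x : PMap X Y) : (x.comp (PMap.id Y)).Same x := by
  have h : IsPullback (𝟙 x.dom) x.map x.map (PMap.id Y).incl := by
    change IsPullback (𝟙 x.dom) x.map x.map (𝟙 Y)
    exact IsPullback.of_horiz_isIso ⟨by simp⟩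
  refine PMap.same_trans (PMap.compOf_same (PMap.same_refl _) (PMap.same_refl _) _ h) ?_
  refine ⟨Iso.refl _, ?_, ?_⟩
  · change 𝟙 _ ≫ x.incl = 𝟙 _ ≫ x.incl
    simp
  · change 𝟙 _ ≫ x.map = x.map ≫ 𝟙 _
    simp

theorem PMap.assoc_same {W X Y Z : IntPreord C} (x : PMap W X) (y : PMap X Y) (z : PMap Y Z) :
    ((x.comp y).comp z).Same (x.comp (y.comp z)) := by
  have h₁ := IntPreord.isPullback_pb x.map y.incl
  have h₂ := IntPreord.isPullback_pb y.map z.incl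
  have h₃ := IntPreord.isPullback_pb (IntPreord.pbSnd x.map y.incl) (IntPreord.pbFst y.map z.incl)
  have hl : IsPullback
      (IntPreord.pbFst (IntPreord.pbSnd x.map y.incl) (IntPreord.pbFst y.map z.incl))
      (IntPreord.pbSnd (IntPreord.pbSnd x.map y.incl) (IntPreord.pbFst y.map z.incl) ≫
        IntPreord.pbSnd y.map z.incl) (x.comp y).map z.incl :=
    (h₃.flip.paste_horiz h₂.flip).flip
  have hr : IsPullback
      (IntPreord.pbFst (IntPreord.pbSnd x.map y.incl) (IntPreord.pbFst y.map z.incl) ≫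
        IntPreord.pbFst x.map y.incl)
      (IntPreord.pbSnd (IntPreord.pbSnd x.map y.incl) (IntPreord.pbFst y.map z.incl))
      x.map (y.comp z).incl :=
    (h₃.flip.paste_vert h₁.flip).flip
  refine PMap.same_trans (PMap.compOf_same (PMap.same_refl _) (PMap.same_refl _) _ hl)
    (PMap.same_trans ?_ (PMap.compOf_same (PMap.same_refl _) (PMap.same_refl _) hr _))
  refine ⟨Iso.refl _, ?_, ?_⟩
  · exact (Category.id_comp _).trans (Category.assoc _ _ _)
  · exact (Category.id_comp _).trans (Category.assoc _ _ _).symm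

end PartialMaps

/-- The objects of the category of partial morphisms of internal preorders. -/
structure PaPreord (C : Type u) [Category.{v} C] where
  /-- the underlying internal preorder -/
  as : IntPreord C

section

variable {C : Type u} [Category.{v} C] [Pretopos C]

noncomputable instance PaPreord.instCategory : Category.{max u v} (PaPreord C) where
  Hom X Y := _root_.Quotient (PMap.setoid X.as Y.as)
  id X := Quotient.mk _ (PMap.id X.as)
  comp := Quotient.map₂ PMap.comp
    (fun _ _ hx _ _ hy => PMap.compOf_same hx hy _ _)
  id_comp := by
    rintro X Y ⟨x⟩
    exact Quotient.sound (PMap.id_comp_same x)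
  comp_id := by
    rintro X Y ⟨x⟩
    exact Quotient.sound (PMap.comp_id_same x)
  assoc := by
    rintro W X Y Z ⟨x⟩ ⟨y⟩ ⟨z⟩
    exact Quotient.sound (PMap.assoc_same x y z)

/-- The partial morphism `(α, f)` that is represented by `α : X' ⟶ X` and `f : X' ⟶ Y`. -/
def PMap.toHom {X Y : PaPreord C} (x : PMap X.as Y.as) : X ⟶ Y :=
  Quotient.mk (PMap.setoid X.as Y.as) x

/-- The functor from internal preorders to partial morphisms. -/
noncomputable def toPaPreord (C : Type u) [Category.{v} C] [Pretopos C] : IntPreord C ⥤ PaPreord C where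
  obj X := ⟨X⟩
  map f := (PMap.ofHom f).toHom
  map_id X := rfl
  map_comp {X Y Z} f g := by
    have h : IsPullback (𝟙 X) f (PMap.ofHom f).map (PMap.ofHom g).incl := by
      change IsPullback (𝟙 X) f f (𝟙 Y)
      exact IsPullback.of_horiz_isIso ⟨by simp⟩
    refine Quotient.sound (PMap.same_symm (PMap.same_trans
      (PMap.compOf_same (PMap.same_refl _) (PMap.same_refl _) _ h) ⟨Iso.refl _, ?_, ?_⟩))
    · change 𝟙 _ ≫ 𝟙 _ = 𝟙 _ ≫ 𝟙 _
      rfl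
    · change 𝟙 _ ≫ f ≫ g = f ≫ g
      simp

/-- There is a congruence diagram between two representatives of partial morphisms: they agree on a
complemented subobject `A₀` of both domains of definition, and are trivial on its complements. -/
def CongruenceDiagram {X Y : IntPreord C} (x y : PMap X Y) : Prop :=
  ∃ (A₀ N₁ N₂ : IntPreord C) (a₁ : A₀ ⟶ x.dom) (a₂ : A₀ ⟶ y.dom) (n₁ : N₁ ⟶ x.dom)
    (n₂ : N₂ ⟶ y.dom), IsComplement a₁ n₁ ∧ IsComplement a₂ n₂ ∧
    IsComplemented (a₁ ≫ x.incl) ∧ a₁ ≫ x.incl = a₂ ≫ y.incl ∧ a₁ ≫ x.map = a₂ ≫ y.map ∧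
    IsTrivialMor (IntPreord.trivialObj C) (n₁ ≫ x.map) ∧
    IsTrivialMor (IntPreord.trivialObj C) (n₂ ≫ y.map)

/-- The relation that defines the stable category. -/
def stableRel (C : Type u) [Category.{v} C] [Pretopos C] : HomRel (PaPreord C) :=
  fun X Y f g => ∃ x y : PMap X.as Y.as, x.toHom = f ∧ y.toHom = g ∧ CongruenceDiagram x y

/-- The stable category. -/
abbrev Stab (C : Type u) [Category.{v} C] [Pretopos C] : Type (max u v) :=
  CategoryTheory.Quotient (stableRel C)

/-- The canonical functor from internal preorders to the stable category. -/
noncomputable def stabFunctor (C : Type u) [Category.{v} C] [Pretopos C] : IntPreord C ⥤ Stab C :=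
  toPaPreord C ⋙ CategoryTheory.Quotient.functor (stableRel C)

theorem isZero_empty_paPreord : IsZero (PaPreord.mk (IntPreord.empty C)) := by
  obtain ⟨hE⟩ := IntPreord.empty_isInitial (C := C)
  have aux : ∀ {X : IntPreord C} (f : X ⟶ IntPreord.empty C), Nonempty (IsInitial X) :=
    fun f => IntPreord.isInitial_of_hom f hE
  constructor
  · intro Y
    refine ⟨⟨⟨((toPaPreord C).map (hE.to Y.as) : _)⟩, fun f => ?_⟩⟩
    obtain ⟨x, rfl⟩ := Quotient.exists_rep f
    obtain ⟨h⟩ := aux x.incl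
    exact Quotient.sound ⟨h.uniqueUpToIso hE, h.hom_ext _ _, h.hom_ext _ _⟩
  · intro Y
    refine ⟨⟨⟨PMap.toHom ⟨IntPreord.empty C, hE.to _, 𝟙 _, ?_⟩⟩, fun f => ?_⟩⟩
    · exact ⟨_, 𝟙 _, IntPreord.isComplement_symm (IntPreord.isComplement_id_empty _ hE)⟩
    · obtain ⟨x, rfl⟩ := Quotient.exists_rep f
      obtain ⟨h⟩ := aux x.map
      exact Quotient.sound ⟨h.uniqueUpToIso hE, h.hom_ext _ _, h.hom_ext _ _⟩

/-- The stable category is pointed, by the empty preorder. -/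
theorem isZero_empty_stab : IsZero ((stabFunctor C).obj (IntPreord.empty C)) := by
  have h := isZero_empty_paPreord (C := C)
  constructor
  · intro Y
    refine ⟨⟨⟨(CategoryTheory.Quotient.functor (stableRel C)).map (h.to_ Y.as)⟩, fun f => ?_⟩⟩
    obtain ⟨g, rfl⟩ := (CategoryTheory.Quotient.functor (stableRel C)).map_surjective f
    exact congrArg _ (h.eq_of_src _ _)
  · intro Y
    refine ⟨⟨⟨(CategoryTheory.Quotient.functor (stableRel C)).map (h.from_ Y.as)⟩, fun f => ?_⟩⟩
    obtain ⟨g, rfl⟩ := (CategoryTheory.Quotient.functor (stableRel C)).map_surjective f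
    exact congrArg _ (h.eq_of_tgt _ _)

instance stabHasZeroObject : HasZeroObject (Stab C) :=
  ⟨_, isZero_empty_stab⟩

/-- The zero morphisms of the pointed category `Stab C`. -/
noncomputable instance stabHasZeroMorphisms : HasZeroMorphisms (Stab C) :=
  HasZeroObject.zeroMorphismsOfZeroObject

end

end PreordStab

/-!
The extension `Gbar` sends the class of a partial morphism `(α, f) : A ⇀ B`, with `α` complemented
by `β`, to the morphism `G A ⟶ G B` that is `G f` on the summand `G A'` and zero on the other
summand (`IsExtension`, `stabExtension`). It is compatible with the congruence of the stable
category because `G` sends trivial morphisms to zero: the image of a trivial object is torsion and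
torsion-free. It is the only extension, because the class of `(α, f)` is `Σ f` after `Σ α`, and
zero after `Σ β`.

For the kernels, let `k₀ : K ⟶ A'` be the `Z`-kernel of `f : A' ⟶ B` (restrict the relation of
`A'` to the pairs with equal images in `B`). The morphism `K ⨿ A'' ⟶ A` given by `k₀` and the
complement `A''` of `A'` is a weak kernel of the class of `(α, f)`, since a partial morphism
becomes zero in the stable category only if it is trivial (`PMap.toStab_eq_zero_iff`). By
pre-universality of the coproducts of the target, `G` sends it to a kernel of `[G f, 0]`
(`IsKernelOf.of_isCop`). This is enough: any kernel in the stable category and this weak kernel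
factor through each other (`IsKernelOf.map_of_weakKernel`).
-/

namespace PreordStab

/-! ### Kernels and coproducts in a pointed category -/

section Target

variable {X : Type u'} [Category.{v'} X]

theorem PreUniversalBinaryCoproducts.exists_decomposition [HasBinaryCoproducts X]
    (h : PreUniversalBinaryCoproducts X) {A B S W : X} {a : A ⟶ S} {b : B ⟶ S} (hab : IsCop a b)
    (f : W ⟶ S) : ∃ (A' B' : X) (s : A' ⟶ W) (t : B' ⟶ W) (f₁ : A' ⟶ A) (f₂ : B' ⟶ B),
      IsCop s t ∧ s ≫ f = f₁ ≫ a ∧ t ≫ f = f₂ ≫ b := by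
  obtain ⟨d, h₁, h₂⟩ := hab.desc (coprod.inl : A ⟶ A ⨿ B) coprod.inr
  have hd : d ≫ coprod.desc a b = 𝟙 S :=
    hab.hom_ext (by rw [← Category.assoc, h₁, coprod.inl_desc, Category.comp_id])
      (by rw [← Category.assoc, h₂, coprod.inr_desc, Category.comp_id])
  obtain ⟨A', B', s, t, f₁, f₂, hst, e₁, e₂⟩ := h (f ≫ d)
  refine ⟨A', B', s, t, f₁, f₂, hst, ?_, ?_⟩
  · have := congrArg (fun u => u ≫ coprod.desc a b) e₁
    simpa only [Category.assoc, hd, Category.comp_id, coprod.inl_desc, coprod.inr_desc] using this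
  · have := congrArg (fun u => u ≫ coprod.desc a b) e₂
    simpa only [Category.assoc, hd, Category.comp_id, coprod.inl_desc, coprod.inr_desc] using this

variable [HasZeroMorphisms X]

theorem isKernelOf_iff {K A B : X} {k : K ⟶ A} {f : A ⟶ B} :
    IsKernelOf k f ↔ Mono k ∧ k ≫ f = 0 ∧
      ∀ {W : X} (l : W ⟶ A), l ≫ f = 0 → ∃ m : W ⟶ K, m ≫ k = l := by
  constructor
  · rintro ⟨w, ⟨hk⟩⟩
    exact ⟨mono_of_isLimit_fork hk, w, fun l hl => ⟨_, (KernelFork.IsLimit.lift' hk l hl).2⟩⟩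
  · rintro ⟨hm, w, hl⟩
    choose m hm' using @hl
    exact ⟨w, ⟨KernelFork.IsLimit.ofι' k w fun l hl => ⟨m l hl, hm' l hl⟩⟩⟩

/-- The kernel of a morphism that is `f₀` on one summand and zero on the other is the sum of the
kernel of `f₀` and the other summand. Pre-universality reduces the claim to generalized elements of
one summand; the summands are separated by the retractions of the coprojections, which vanish on the
other summand. -/
theorem IsKernelOf.of_isCop [HasBinaryCoproducts X] (hpre : PreUniversalBinaryCoproducts X)
    {A A₁ A₂ K S B : X} {a : A₁ ⟶ A} {c : A₂ ⟶ A} (hA : IsCop a c) {i : K ⟶ S} {j : A₂ ⟶ S}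
    (hS : IsCop i j) {f₀ : A₁ ⟶ B} {k₀ : K ⟶ A₁} (hk₀ : IsKernelOf k₀ f₀) {k : S ⟶ A} {f : A ⟶ B}
    (hi : i ≫ k = k₀ ≫ a) (hj : j ≫ k = c) (hf : a ≫ f = f₀) (hf' : c ≫ f = 0) :
    IsKernelOf k f := by
  obtain ⟨hm, hw, hl⟩ := isKernelOf_iff.1 hk₀
  obtain ⟨ra, ra₁, ra₂⟩ := hA.desc (𝟙 A₁) (0 : A₂ ⟶ A₁)
  obtain ⟨rc, rc₁, rc₂⟩ := hA.desc (0 : A₁ ⟶ A₂) (𝟙 A₂)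
  -- two generalized elements of the same summand are separated by the retractions of `a` and `c`
  have sepK : ∀ {V : X} (u u' : V ⟶ K), u ≫ i ≫ k = u' ≫ i ≫ k → u = u' := by
    intro V u u' e
    rw [hi] at e
    have := congrArg (fun t => t ≫ ra) e
    simp only [Category.assoc, ra₁, Category.comp_id] at this
    exact (cancel_mono k₀).1 this
  have sepA : ∀ {V : X} (u u' : V ⟶ A₂), u ≫ j ≫ k = u' ≫ j ≫ k → u = u' := by
    intro V u u' e
    rw [hj] at e
    have := congrArg (fun t => t ≫ rc) e
    simpa only [Category.assoc, rc₂, Category.comp_id] using this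
  -- generalized elements of different summands agree only if they vanish
  have sepKA : ∀ {V : X} (u : V ⟶ K) (u' : V ⟶ A₂), u ≫ i ≫ k = u' ≫ j ≫ k →
      u = 0 ∧ u' = 0 := by
    intro V u u' e
    rw [hi, hj] at e
    constructor
    · have := congrArg (fun t => t ≫ ra) e
      simp only [Category.assoc, ra₁, ra₂, Category.comp_id, comp_zero] at this
      exact (cancel_mono k₀).1 (this.trans zero_comp.symm)
    · have := congrArg (fun t => t ≫ rc) e
      simp only [Category.assoc, rc₁, rc₂, Category.comp_id, comp_zero] at this
      exact this.symm
  refine isKernelOf_iff.2 ⟨⟨fun {W} s t e => ?_⟩, hS.hom_ext ?_ ?_, fun {W} l e => ?_⟩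
  · obtain ⟨V₁, V₂, v₁, v₂, s₁, s₂, hV, hs₁, hs₂⟩ := hpre.exists_decomposition hS s
    refine hV.hom_ext ?_ ?_
    · obtain ⟨U₁, U₂, u₁, u₂, t₁, t₂, hU, ht₁, ht₂⟩ := hpre.exists_decomposition hS (v₁ ≫ t)
      have e₁ : u₁ ≫ v₁ ≫ s = (u₁ ≫ s₁) ≫ i := by rw [hs₁, Category.assoc]
      have e₂ : u₂ ≫ v₁ ≫ s = (u₂ ≫ s₁) ≫ i := by rw [hs₁, Category.assoc]
      refine hU.hom_ext ?_ ?_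
      · have : u₁ ≫ s₁ = t₁ := sepK _ _ (by
          rw [← Category.assoc, ← e₁, ← Category.assoc t₁, ← ht₁]; simp [e])
        rw [e₁, ht₁, this]
      · obtain ⟨z₁, z₂⟩ := sepKA (u₂ ≫ s₁) t₂ (by
          rw [← Category.assoc, ← e₂, ← Category.assoc t₂, ← ht₂]; simp [e])
        rw [e₂, ht₂, z₁, z₂, zero_comp, zero_comp]
    · obtain ⟨U₁, U₂, u₁, u₂, t₁, t₂, hU, ht₁, ht₂⟩ := hpre.exists_decomposition hS (v₂ ≫ t)
      have e₁ : u₁ ≫ v₂ ≫ s = (u₁ ≫ s₂) ≫ j := by rw [hs₂, Category.assoc]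
      have e₂ : u₂ ≫ v₂ ≫ s = (u₂ ≫ s₂) ≫ j := by rw [hs₂, Category.assoc]
      refine hU.hom_ext ?_ ?_
      · obtain ⟨z₁, z₂⟩ := sepKA t₁ (u₁ ≫ s₂) (by
          rw [← Category.assoc t₁, ← ht₁, ← Category.assoc (u₁ ≫ s₂), ← e₁]; simp [e])
        rw [e₁, ht₁, z₁, z₂, zero_comp, zero_comp]
      · have : u₂ ≫ s₂ = t₂ := sepA _ _ (by
          rw [← Category.assoc, ← e₂, ← Category.assoc t₂, ← ht₂]; simp [e])
        rw [e₂, ht₂, this]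
  · rw [← Category.assoc, hi, Category.assoc, hf, hw, comp_zero]
  · rw [← Category.assoc, hj, hf', comp_zero]
  · obtain ⟨V₁, V₂, v₁, v₂, l₁, l₂, hV, h₁, h₂⟩ := hpre.exists_decomposition hA l
    obtain ⟨m, hm⟩ := hl l₁ (by
      rw [← hf, ← Category.assoc, ← h₁, Category.assoc, e, comp_zero])
    obtain ⟨d, d₁, d₂⟩ := hV.desc (m ≫ i) (l₂ ≫ j)
    refine ⟨d, hV.hom_ext ?_ ?_⟩
    · rw [← Category.assoc, d₁, Category.assoc, hi, ← Category.assoc, hm, h₁]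
    · rw [← Category.assoc, d₂, Category.assoc, hj, h₂]

end Target

/-! ### Trivial morphisms and complements of internal preorders -/

namespace IntPreord

section

variable {C : Type u} [Category.{v} C]

/-- In a trivial preorder, related elements are equal. -/
theorem r₁_eq_r₂_of_trivialObj {X : IntPreord C} (h : trivialObj C X) : X.r₁ = X.r₂ := by
  obtain ⟨⟨s, h₁, h₂⟩, hp⟩ := h
  simpa using hp (𝟙 _) s (by simpa using h₂.symm) (by simpa using h₁.symm)

variable [HasPullbacks C]

theorem trivialObj_discrete (X : C) : trivialObj C (discrete X) :=
  ⟨⟨𝟙 X, Category.comp_id _, Category.comp_id _⟩, fun _ _ _ _ => rfl⟩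

/-- A morphism that identifies related elements factors through the discrete preorder. -/
theorem exists_factor_discrete {X Y : IntPreord C} (f : X ⟶ Y)
    (h : X.r₁ ≫ Hom.base f = X.r₂ ≫ Hom.base f) :
    ∃ g : X ⟶ discrete Y.carrier, Hom.base g = Hom.base f :=
  ⟨(Hom.mk (Hom.base f :) (X.r₁ ≫ Hom.base f :) (Category.comp_id _).symm
    (h.symm.trans (Category.comp_id _).symm) : Hom X (discrete Y.carrier)), rfl⟩

/-- A morphism is trivial if and only if it sends related elements to equal elements. -/
theorem isTrivialMor_iff {X Y : IntPreord C} (f : X ⟶ Y) :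
    IsTrivialMor (trivialObj C) f ↔ X.r₁ ≫ Hom.base f = X.r₂ ≫ Hom.base f := by
  constructor
  · rintro ⟨W, g, h, hW, rfl⟩
    rw [comp_base, ← Category.assoc, ← Category.assoc, Hom.comm₁, Hom.comm₂,
      r₁_eq_r₂_of_trivialObj hW]
  · intro h
    obtain ⟨g, hg⟩ := exists_factor_discrete f h
    obtain ⟨ι, hι⟩ := exists_discrete_hom (𝟙 Y.carrier)
    exact ⟨_, g, ι, trivialObj_discrete _, hom_ext (by
      rw [comp_base, hg, hι]
      exact Category.comp_id _)⟩

/-- The kernel of `f`: two elements are related if they are related in the domain and have the same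
image. It is the pullback of `f` along the inclusion of the discrete preorder. -/
theorem exists_isZKernel {X Y : IntPreord C} (f : X ⟶ Y) :
    ∃ (K : IntPreord C) (k : K ⟶ X), IsZKernel (trivialObj C) k f := by
  obtain ⟨ι, hι⟩ := exists_discrete_hom (𝟙 Y.carrier)
  have hp := isPullback_pb f ι
  have : Mono ι := mono_of_base ι (by rw [hι]; exact inferInstanceAs (Mono (𝟙 _)))
  refine ⟨pb f ι, pbFst f ι, ⟨_, _, ι, trivialObj_discrete _, hp.w.symm⟩, fun {W} l hl => ?_⟩
  obtain ⟨g, hg⟩ := exists_factor_discrete _ ((isTrivialMor_iff _).1 hl)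
  have e : l ≫ f = g ≫ ι := hom_ext (by
    rw [comp_base g, hg, hι]
    exact (Category.comp_id _).symm)
  refine ⟨hp.lift l g e, hp.lift_fst _ _ _, fun m hm => hp.hom_ext ?_ ?_⟩
  · rw [hm, hp.lift_fst]
  · rw [← cancel_mono ι, hp.lift_snd, Category.assoc, ← hp.w, ← Category.assoc, hm, e]

end

section

variable {C : Type u} [Category.{v} C] [FinitaryExtensive C] [HasPullbacks C]

/-- Triviality on a pullback, in terms of generalized elements of the relations. -/
theorem isTrivialMor_iff_of_isPullback {P X Y Z W : IntPreord C} {p : P ⟶ X} {q : P ⟶ Y}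
    {f : X ⟶ Z} {g : Y ⟶ Z} (h : IsPullback p q f g) (m : Y ⟶ W) :
    IsTrivialMor (trivialObj C) (q ≫ m) ↔
      ∀ {S : C} (s : S ⟶ X.rel) (t : S ⟶ Y.rel), s ≫ Hom.onRel f = t ≫ Hom.onRel g →
        t ≫ Y.r₁ ≫ Hom.base m = t ≫ Y.r₂ ≫ Hom.base m := by
  have hr := isPullback_onRel h
  rw [isTrivialMor_iff, comp_base, ← Category.assoc, ← Category.assoc, Hom.comm₁, Hom.comm₂,
    Category.assoc, Category.assoc]
  constructor
  · intro h S s t e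
    have := congrArg (fun u => hr.lift s t e ≫ u) h
    simpa only [← Category.assoc, hr.lift_snd] using this
  · intro h
    exact h _ _ hr.w

theorem isCop_of_isComplement {X Y B : IntPreord C} {a : X ⟶ B} {b : Y ⟶ B}
    (h : IsComplement a b) : IsCop a b := by
  obtain ⟨hb, hr⟩ := (isComplement_iff a b).1 h
  refine IsCop.of_desc (fun f g => exists_desc hb hr f g) (fun f g h₁ h₂ => hom_ext ?_)
  exact hb.hom_ext (congrArg Hom.base h₁) (congrArg Hom.base h₂)

theorem exists_isComplement_sum (X Y : IntPreord C) :
    ∃ (S : IntPreord C) (i : X ⟶ S) (j : Y ⟶ S), IsComplement i j := by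
  obtain ⟨S, i, j, h⟩ := exists_sum X Y
  exact ⟨S, i, j, (isComplement_iff i j).2 h⟩

theorem isComplement_of_isPullback {P P' X Y Y' Z : IntPreord C} {f : X ⟶ Z} {g : Y ⟶ Z}
    {g' : Y' ⟶ Z} (hg : IsComplement g g') {p : P ⟶ X} {q : P ⟶ Y} (h : IsPullback p q f g)
    {p' : P' ⟶ X} {q' : P' ⟶ Y'} (h' : IsPullback p' q' f g') : IsComplement p p' := by
  rw [isComplement_iff] at hg ⊢
  exact ⟨hg.1.of_isPullback (isPullback_base h) (isPullback_base h'),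
    hg.2.of_isPullback (isPullback_onRel h) (isPullback_onRel h')⟩

/-- The complement of a composite of complemented subobjects is the sum of the complements. -/
theorem exists_isComplement_comp {X X' Y Y' Z : IntPreord C} {f : X ⟶ Y} {f' : X' ⟶ Y}
    {g : Y ⟶ Z} {g' : Y' ⟶ Z} (hf : IsComplement f f') (hg : IsComplement g g') :
    ∃ (S : IntPreord C) (i : X' ⟶ S) (j : Y' ⟶ S) (d : S ⟶ Z), IsComplement i j ∧
      i ≫ d = f' ≫ g ∧ j ≫ d = g' ∧ IsComplement (f ≫ g) d := by
  obtain ⟨S, i, j, hij⟩ := exists_isComplement_sum X' Y'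
  obtain ⟨d, h₁, h₂⟩ := (isCop_of_isComplement hij).desc (f' ≫ g) g'
  refine ⟨S, i, j, d, hij, h₁, h₂, ?_⟩
  rw [isComplement_iff] at hf hg hij ⊢
  exact ⟨hg.1.assoc hf.1 hij.1 (congrArg Hom.base h₁) (congrArg Hom.base h₂),
    hg.2.assoc hf.2 hij.2 (congrArg Hom.onRel h₁) (congrArg Hom.onRel h₂)⟩

/-- A complement of `a` contains any other one. -/
theorem exists_factor_of_isComplement {X Y Y' B : IntPreord C} {a : X ⟶ B} {b : Y ⟶ B}
    {b' : Y' ⟶ B} (h : IsComplement a b) (h' : IsComplement a b') : ∃ g : Y' ⟶ Y, g ≫ b = b' := by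
  -- The pullback of `a` along `b'` is initial, hence that of `b` is an isomorphism.
  have hc := isComplement_of_isPullback h (isPullback_pb b' a) (isPullback_pb b' b)
  obtain ⟨P, p, q, hP, ⟨hI⟩⟩ := h'.inter
  obtain ⟨hI'⟩ := isInitial_of_hom
    (hP.lift (pbSnd b' a) (pbFst b' a) (isPullback_pb b' a).w.symm) hI
  obtain ⟨d, -, hd⟩ := (isCop_of_isComplement hc).desc (hI'.to (pb b' b)) (𝟙 _)
  have hd' : d ≫ pbFst b' b = 𝟙 Y' :=
    (isCop_of_isComplement hc).hom_ext (hI'.hom_ext _ _)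
      (by rw [← Category.assoc, hd, Category.id_comp, Category.comp_id])
  exact ⟨d ≫ pbSnd b' b, by
    rw [Category.assoc, ← (isPullback_pb b' b).w, ← Category.assoc, hd', Category.id_comp]⟩

end

end IntPreord

/-! ### Zero morphisms of the stable category -/

section Stable

open IntPreord

variable {C : Type u} [Category.{v} C]

theorem CongruenceDiagram.symm {X Y : IntPreord C} {x y : PMap X Y} (h : CongruenceDiagram x y) :
    CongruenceDiagram y x := by
  obtain ⟨A₀, N₁, N₂, a₁, a₂, n₁, n₂, h₁, h₂, hc, hi, hm, t₁, t₂⟩ := h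
  exact ⟨A₀, N₂, N₁, a₂, a₁, n₂, n₁, h₂, h₁, hi ▸ hc, hi.symm, hm.symm, t₂, t₁⟩

variable [Pretopos C]

theorem PMap.toHom_comp_toHom {X Y Z : PaPreord C} (x : PMap X.as Y.as) (y : PMap Y.as Z.as)
    {P : IntPreord C} {p : P ⟶ x.dom} {q : P ⟶ y.dom} (h : IsPullback p q x.map y.incl) :
    x.toHom ≫ y.toHom = (PMap.toHom (x.compOf y h) : X ⟶ Z) :=
  Quotient.sound (PMap.compOf_same (PMap.same_refl _) (PMap.same_refl _) _ h)

theorem PMap.exists_toHom {X Y : PaPreord C} (f : X ⟶ Y) : ∃ x : PMap X.as Y.as, x.toHom = f :=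
  Quotient.exists_rep f

theorem PMap.toHom_eq_iff {X Y : PaPreord C} {x y : PMap X.as Y.as} :
    (x.toHom : X ⟶ Y) = y.toHom ↔ x.Same y :=
  Quotient.eq (r := PMap.setoid X.as Y.as)

/-- The partial morphisms that are trivial on their domain of definition. -/
def IsTrivialPartial {X Y : PaPreord C} (f : X ⟶ Y) : Prop :=
  ∃ x : PMap X.as Y.as, x.toHom = f ∧ IsTrivialMor (trivialObj C) x.map

theorem isTrivialPartial_toHom_iff {X Y : PaPreord C} (x : PMap X.as Y.as) :
    IsTrivialPartial (x.toHom : X ⟶ Y) ↔ IsTrivialMor (trivialObj C) x.map := by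
  refine ⟨?_, fun h => ⟨x, rfl, h⟩⟩
  rintro ⟨y, hy, W, g, h, hW, e⟩
  obtain ⟨i, -, hi⟩ := PMap.toHom_eq_iff.1 hy.symm
  exact ⟨W, i.hom ≫ g, h, hW, by rw [Category.assoc, e, hi]⟩

/-- Triviality of a threefold composite, in terms of generalized elements. -/
theorem isTrivialPartial_comp_iff {U X Y V : PaPreord C} (f : PMap U.as X.as) (x : PMap X.as Y.as)
    (g : PMap Y.as V.as) :
    IsTrivialPartial ((f.toHom : U ⟶ X) ≫ (x.toHom : X ⟶ Y) ≫ (g.toHom : Y ⟶ V)) ↔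
      ∀ {S : C} (s : S ⟶ f.dom.rel) (t : S ⟶ x.dom.rel) (u : S ⟶ g.dom.rel),
        s ≫ Hom.onRel f.map = t ≫ Hom.onRel x.incl →
        t ≫ Hom.onRel x.map = u ≫ Hom.onRel g.incl →
        u ≫ g.dom.r₁ ≫ Hom.base g.map = u ≫ g.dom.r₂ ≫ Hom.base g.map := by
  refine (isTrivialPartial_toHom_iff (X := U) (Y := V) (f.comp (x.comp g))).trans ?_
  have h₁ := isPullback_pb x.map g.incl
  refine (isTrivialMor_iff_of_isPullback (isPullback_pb f.map (pbFst x.map g.incl ≫ x.incl))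
    (pbSnd x.map g.incl ≫ g.map)).trans ?_
  have hr := isPullback_onRel h₁
  have e₁ := congrArg (fun u => u ≫ Hom.base g.map) (Hom.comm₁ (pbSnd x.map g.incl))
  have e₂ := congrArg (fun u => u ≫ Hom.base g.map) (Hom.comm₂ (pbSnd x.map g.incl))
  simp only [Category.assoc] at e₁ e₂
  simp only [comp_base, e₁, e₂, comp_onRel]
  constructor
  · intro h S s t u e e'
    have := h s (hr.lift t u e') (by rw [← Category.assoc, hr.lift_fst, e])
    simpa only [← Category.assoc, hr.lift_snd] using this
  · intro h S s t e
    have := h s (t ≫ Hom.onRel (pbFst x.map g.incl)) (t ≫ Hom.onRel (pbSnd x.map g.incl))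
      (e.trans (Category.assoc _ _ _).symm) (by rw [Category.assoc, hr.w, Category.assoc])
    simpa only [Category.assoc] using this

/-- A congruence diagram from `x` to `y` carries triviality of `f ≫ x ≫ g` to `f ≫ y ≫ g`: a
related pair in the domain of `y` splits into a part where `x` and `y` agree and a part that `y`
sends to the diagonal. -/
theorem IsTrivialPartial.of_congruenceDiagram {U X Y V : PaPreord C} (f : U ⟶ X)
    {x y : PMap X.as Y.as} (h : CongruenceDiagram x y) (g : Y ⟶ V)
    (hx : IsTrivialPartial (f ≫ (x.toHom : X ⟶ Y) ≫ g)) :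
    IsTrivialPartial (f ≫ (y.toHom : X ⟶ Y) ≫ g) := by
  obtain ⟨f, rfl⟩ := PMap.exists_toHom f
  obtain ⟨g, rfl⟩ := PMap.exists_toHom g
  rw [isTrivialPartial_comp_iff] at hx ⊢
  intro S s t u e e'
  obtain ⟨A₀, N₁, N₂, a₁, a₂, n₁, n₂, -, hy, -, hi, hm, -, hn⟩ := h
  obtain ⟨S₁, S₂, i, j, t₁, t₂, hS, h₁, h₂⟩ := ((isComplement_iff _ _).1 hy).2.split t
  refine hS.hom_ext ?_ ?_
  · have := hx (i ≫ s) (t₁ ≫ Hom.onRel a₁) (i ≫ u)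
      (by
        rw [Category.assoc, e, Category.assoc, ← comp_onRel, hi, comp_onRel, ← Category.assoc,
          ← Category.assoc, h₁])
      (by
        rw [Category.assoc i, ← e', Category.assoc, ← comp_onRel, hm, comp_onRel, ← Category.assoc,
          ← Category.assoc, h₁])
    simpa only [Category.assoc] using this
  · have hg : Mono (Hom.base g.incl) := by
      obtain ⟨_, _, hg⟩ := g.complemented
      exact ((isComplement_iff _ _).1 hg).1.mono_left
    have k : (j ≫ u) ≫ g.dom.r₁ = (j ≫ u) ≫ g.dom.r₂ := by
      have hu : (j ≫ u) ≫ Hom.onRel g.incl = t₂ ≫ Hom.onRel (n₂ ≫ y.map) := by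
        rw [Category.assoc, ← e', ← Category.assoc, h₂, Category.assoc, comp_onRel]
      rw [← cancel_mono (Hom.base g.incl), Category.assoc (j ≫ u), Category.assoc (j ≫ u),
        Hom.comm₁, Hom.comm₂, ← Category.assoc (j ≫ u), ← Category.assoc (j ≫ u), hu,
        Category.assoc, Category.assoc,
        ← Hom.comm₁, ← Hom.comm₂, (isTrivialMor_iff _).1 hn]
    have := congrArg (fun t => t ≫ Hom.base g.map) k
    simpa only [Category.assoc] using this

/-- Triviality of partial morphisms is invariant under the congruence. -/
theorem isTrivialPartial_iff_of_stab_eq {X Y : PaPreord C} {f g : X ⟶ Y}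
    (h : (CategoryTheory.Quotient.functor (stableRel C)).map f =
      (CategoryTheory.Quotient.functor (stableRel C)).map g) :
    IsTrivialPartial f ↔ IsTrivialPartial g := by
  have h' : Relation.EqvGen (@HomRel.CompClosure _ _ (stableRel C) X Y) f g := by
    rw [← CategoryTheory.Quotient.functor_homRel_eq_compClosure_eqvGen]
    exact h
  clear h
  induction h' with
  | rel _ _ h =>
    obtain ⟨_, _, a, _, _, b, x, y, rfl, rfl, h⟩ := h
    exact ⟨.of_congruenceDiagram a h b, .of_congruenceDiagram a h.symm b⟩
  | refl => rfl
  | symm _ _ _ ih => exact ih.symm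
  | trans _ _ _ _ _ ih ih' => exact ih.trans ih'

/-- The class of a partial morphism in the stable category. -/
noncomputable def PMap.toStab {X Y : IntPreord C} (x : PMap X Y) :
    (stabFunctor C).obj X ⟶ (stabFunctor C).obj Y :=
  (CategoryTheory.Quotient.functor (stableRel C)).map (PMap.toHom (X := ⟨X⟩) (Y := ⟨Y⟩) x)

theorem PMap.toStab_comp_toStab {X Y Z : IntPreord C} (x : PMap X Y) (y : PMap Y Z)
    {P : IntPreord C} {p : P ⟶ x.dom} {q : P ⟶ y.dom} (h : IsPullback p q x.map y.incl) :
    x.toStab ≫ y.toStab = (x.compOf y h).toStab :=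
  ((CategoryTheory.Quotient.functor (stableRel C)).map_comp _ _).symm.trans
    (congrArg _ (PMap.toHom_comp_toHom (X := ⟨X⟩) (Y := ⟨Y⟩) (Z := ⟨Z⟩) x y h))

theorem PMap.exists_toStab {X Y : IntPreord C}
    (f : (stabFunctor C).obj X ⟶ (stabFunctor C).obj Y) : ∃ x : PMap X Y, x.toStab = f := by
  obtain ⟨g, rfl⟩ := (CategoryTheory.Quotient.functor (stableRel C)).map_surjective f
  obtain ⟨x, hx⟩ := PMap.exists_toHom g
  exact ⟨x, congrArg _ hx⟩

theorem PMap.toStab_eq_of_same {X Y : IntPreord C} {x y : PMap X Y} (h : x.Same y) :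
    x.toStab = y.toStab :=
  congrArg (CategoryTheory.Quotient.functor (stableRel C)).map
    (PMap.toHom_eq_iff (X := ⟨X⟩) (Y := ⟨Y⟩).2 h)

theorem PMap.toStab_eq_of_congruenceDiagram {X Y : IntPreord C} {x y : PMap X Y}
    (h : CongruenceDiagram x y) : x.toStab = y.toStab :=
  CategoryTheory.Quotient.sound _ ⟨x, y, rfl, rfl, h⟩

/-- The nowhere defined partial morphisms are the zero morphisms. -/
theorem PMap.toStab_eq_zero_of_isInitial {X Y : IntPreord C} (x : PMap X Y) (h : IsInitial x.dom) :
    x.toStab = 0 := by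
  obtain ⟨hE⟩ := empty_isInitial (C := C)
  let u : PMap X (empty C) := ⟨empty C, hE.to X, 𝟙 _, _, 𝟙 _,
    isComplement_symm (isComplement_id_empty _ hE)⟩
  have hp : IsPullback (𝟙 (empty C)) (𝟙 _) u.map (PMap.ofHom (hE.to Y)).incl := by
    change IsPullback (𝟙 (empty C)) (𝟙 _) (𝟙 _) (𝟙 _)
    exact IsPullback.of_horiz_isIso ⟨rfl⟩
  have hu : x.toStab = u.toStab ≫ (PMap.ofHom (hE.to Y)).toStab := by
    rw [PMap.toStab_comp_toStab _ _ hp]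
    exact PMap.toStab_eq_of_same ⟨h.uniqueUpToIso hE, h.hom_ext _ _, h.hom_ext _ _⟩
  rw [hu, isZero_empty_stab.eq_zero_of_tgt u.toStab, zero_comp]

/-- The zero morphisms of the stable category are the classes of the trivial partial morphisms. -/
theorem PMap.toStab_eq_zero_iff {X Y : IntPreord C} (x : PMap X Y) :
    x.toStab = 0 ↔ IsTrivialMor (trivialObj C) x.map := by
  obtain ⟨hE⟩ := empty_isInitial (C := C)
  have hc : IsComplement (hE.to X) (𝟙 X) := isComplement_symm (isComplement_id_empty _ hE)
  let z : PMap X Y := ⟨empty C, hE.to X, hE.to Y, _, _, hc⟩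
  have hz : z.toStab = 0 := z.toStab_eq_zero_of_isInitial hE
  have ht : ∀ {W : IntPreord C} (f : empty C ⟶ W), IsTrivialMor (trivialObj C) f := fun f =>
    ⟨_, 𝟙 _, f, trivialObj_discrete _, Category.id_comp _⟩
  rw [← hz]
  constructor
  · intro h
    exact (isTrivialPartial_toHom_iff (X := ⟨X⟩) (Y := ⟨Y⟩) x).1
      ((isTrivialPartial_iff_of_stab_eq h).2 ⟨z, rfl, ht _⟩)
  · intro h
    exact PMap.toStab_eq_of_congruenceDiagram ⟨empty C, x.dom, empty C, hE.to _, 𝟙 _, 𝟙 _, 𝟙 _,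
      isComplement_symm (isComplement_id_empty _ hE), isComplement_id_empty _ hE,
      (hE.hom_ext (hE.to X) (hE.to x.dom ≫ x.incl)) ▸ ⟨_, _, hc⟩, hE.hom_ext _ _, hE.hom_ext _ _,
      (Category.id_comp x.map).symm ▸ h, ht _⟩

theorem stabFunctor_map_comp_toStab {X Y Z : IntPreord C} (f : X ⟶ Y) (x : PMap Y Z)
    {P : IntPreord C} {p : P ⟶ X} {q : P ⟶ x.dom} (h : IsPullback p q f x.incl) :
    (stabFunctor C).map f ≫ x.toStab = ((PMap.ofHom f).compOf x h).toStab :=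
  PMap.toStab_comp_toStab (PMap.ofHom f) x h

/-- On its domain of definition, a partial morphism is a morphism of internal preorders. -/
theorem PMap.stabFunctor_map_incl_comp_toStab {X Y : IntPreord C} (x : PMap X Y) :
    (stabFunctor C).map x.incl ≫ x.toStab = (stabFunctor C).map x.map := by
  have : Mono x.incl := x.complemented.choose_spec.choose_spec.mono_left
  refine (stabFunctor_map_comp_toStab x.incl x (IsKernelPair.id_of_mono x.incl)).trans
    (PMap.toStab_eq_of_same (y := PMap.ofHom x.map) ⟨Iso.refl _, rfl, rfl⟩)

/-- A partial morphism vanishes on the complement of its domain of definition. -/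
theorem PMap.stabFunctor_map_comp_toStab_eq_zero {X Y N : IntPreord C} (x : PMap X Y) {n : N ⟶ X}
    (hn : IsComplement x.incl n) : (stabFunctor C).map n ≫ x.toStab = 0 := by
  obtain ⟨P, p, q, hP, ⟨hI⟩⟩ := hn.inter
  rw [stabFunctor_map_comp_toStab n x hP.flip]
  exact PMap.toStab_eq_zero_of_isInitial _ hI

theorem PMap.toStab_comp_stabFunctor_map {X Y Z : IntPreord C} (x : PMap X Y) (f : Y ⟶ Z) :
    x.toStab ≫ (stabFunctor C).map f =
      (⟨x.dom, x.incl, x.map ≫ f, x.complemented⟩ : PMap X Z).toStab := by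
  have h : IsPullback (𝟙 x.dom) x.map x.map (PMap.ofHom f).incl := by
    change IsPullback (𝟙 x.dom) x.map x.map (𝟙 Y)
    exact IsPullback.of_horiz_isIso ⟨by simp⟩
  refine (PMap.toStab_comp_toStab x (PMap.ofHom f) h).trans (PMap.toStab_eq_of_same
    ⟨Iso.refl _, ?_, ?_⟩)
  · change 𝟙 _ ≫ x.incl = 𝟙 _ ≫ x.incl
    rfl
  · change 𝟙 _ ≫ x.map ≫ f = x.map ≫ f
    simp

/-! ### Kernels in the stable category -/

/-- The sum of the kernel of `x` on its domain of definition and of the complement of that domain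
is sent to zero: the complement is outside the domain of definition. -/
theorem PMap.stabFunctor_map_kernel_comp_toStab {X Y : IntPreord C} (x : PMap X Y)
    {N K S : IntPreord C} {n : N ⟶ X} (hn : IsComplement x.incl n) {k₀ : K ⟶ x.dom}
    (hk₀ : IsZKernel (trivialObj C) k₀ x.map) {i : K ⟶ S} {j : N ⟶ S} (hS : IsComplement i j)
    {k : S ⟶ X} (hi : i ≫ k = k₀ ≫ x.incl) (hj : j ≫ k = n) :
    (stabFunctor C).map k ≫ x.toStab = 0 := by
  rw [stabFunctor_map_comp_toStab k x (isPullback_pb k x.incl), PMap.toStab_eq_zero_iff]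
  refine (isTrivialMor_iff_of_isPullback (isPullback_pb k x.incl) x.map).2 fun s t e => ?_
  obtain ⟨l, -, rfl⟩ := exists_left ((isComplement_iff _ _).1 hn).2 ((isComplement_iff _ _).1 hS).2
    (x := Hom.onRel k₀) (y := 𝟙 _) (f := Hom.onRel k) (congrArg Hom.onRel hi).symm
    ((Category.id_comp _).trans (congrArg Hom.onRel hj).symm) s t e
  have := (isTrivialMor_iff _).1 hk₀.trivial
  simp only [comp_base, ← Category.assoc, Hom.comm₁, Hom.comm₂] at this
  have := congrArg (fun u => l ≫ u) this
  simpa only [Category.assoc] using this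

/-- A partial morphism `y` whose composite with `x` is zero factors through the sum of the kernel of
`x` on its domain of definition and of the complement of that domain: `y` splits into the part that
`x` is defined on, where the composite is trivial, and the part that is sent to the complement. -/
theorem PMap.exists_factor_kernel {X Y : IntPreord C} (x : PMap X Y) {N K S : IntPreord C}
    {n : N ⟶ X} (hn : IsComplement x.incl n) {k₀ : K ⟶ x.dom}
    (hk₀ : IsZKernel (trivialObj C) k₀ x.map) {i : K ⟶ S} {j : N ⟶ S} {k : S ⟶ X}
    (hi : i ≫ k = k₀ ≫ x.incl) (hj : j ≫ k = n) {W : IntPreord C}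
    (l : (stabFunctor C).obj W ⟶ (stabFunctor C).obj X) (hl : l ≫ x.toStab = 0) :
    ∃ m : (stabFunctor C).obj W ⟶ (stabFunctor C).obj S, m ≫ (stabFunctor C).map k = l := by
  obtain ⟨y, rfl⟩ := PMap.exists_toStab l
  have h₁ := isPullback_pb y.map x.incl
  have h₂ := isPullback_pb y.map n
  rw [PMap.toStab_comp_toStab y x h₁, PMap.toStab_eq_zero_iff] at hl
  obtain ⟨m, hm, -⟩ := hk₀.existsUnique (pbSnd y.map x.incl) hl
  have hc := isCop_of_isComplement (isComplement_of_isPullback hn h₁ h₂)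
  obtain ⟨d, d₁, d₂⟩ := hc.desc (m ≫ i) (pbSnd y.map n ≫ j)
  have hd : d ≫ k = y.map := by
    refine hc.hom_ext ?_ ?_
    · rw [← Category.assoc, d₁, Category.assoc, hi, ← Category.assoc, hm, h₁.w]
    · rw [← Category.assoc, d₂, Category.assoc, hj, h₂.w]
  refine ⟨(⟨y.dom, y.incl, d, y.complemented⟩ : PMap W S).toStab, ?_⟩
  simp only [PMap.toStab_comp_stabFunctor_map, hd]

end Stable

/-- A functor preserves every kernel of `f` as soon as it sends one weak kernel of `f` to a kernel:
a kernel and a weak kernel factor through each other. -/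
theorem IsKernelOf.map_of_weakKernel {A : Type u} [Category.{v} A] [HasZeroMorphisms A]
    {B : Type u'} [Category.{v'} B] [HasZeroMorphisms B] (H : A ⥤ B) {K K' X Y : A} {f : X ⟶ Y}
    {k' : K' ⟶ X} (hw : k' ≫ f = 0)
    (hl : ∀ {W : A} (l : W ⟶ X), l ≫ f = 0 → ∃ m : W ⟶ K', m ≫ k' = l)
    (hH : IsKernelOf (H.map k') (H.map f)) {k : K ⟶ X} (hk : IsKernelOf k f) :
    IsKernelOf (H.map k) (H.map f) := by
  obtain ⟨hk₁, hk₂, hk₃⟩ := isKernelOf_iff.1 hk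
  obtain ⟨hm, hH₂, hH₃⟩ := isKernelOf_iff.1 hH
  obtain ⟨p, hp⟩ := hk₃ k' hw
  obtain ⟨q, hq⟩ := hl k hk₂
  have hqp : q ≫ p = 𝟙 K := by
    rw [← cancel_mono k, Category.assoc, hp, hq, Category.id_comp]
  have : IsSplitMono q := ⟨⟨p, hqp⟩⟩
  refine isKernelOf_iff.2 ⟨?_, ?_, fun l e => ?_⟩
  · rw [← hq, H.map_comp]
    infer_instance
  · rw [← hq, H.map_comp, Category.assoc, hH₂, comp_zero]
  · obtain ⟨m, rfl⟩ := hH₃ l e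
    exact ⟨m ≫ H.map p, by rw [Category.assoc, ← H.map_comp, hp]⟩

/-! ### The extension of a functor to the stable category -/

section Extension

open IntPreord

variable {C : Type u} [Category.{v} C] {X : Type u'} [Category.{v'} X]

theorem map_eq_zero_of_isInitial [HasZeroMorphisms X] {G : IntPreord C ⥤ X}
    [PreservesFiniteCoproducts G] {A : IntPreord C} (hA : IsInitial A) {Y : X} (f : G.obj A ⟶ Y) :
    f = 0 :=
  (IsInitial.isInitialObj G A hA).hom_ext _ _

variable [Pretopos C] (G : IntPreord C ⥤ X)

theorem isCop_map_of_isComplement [PreservesFiniteCoproducts G] {A B W : IntPreord C} {a : A ⟶ W}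
    {b : B ⟶ W} (h : IsComplement a b) : IsCop (G.map a) (G.map b) := by
  obtain ⟨hc⟩ := isCop_of_isComplement h
  exact ⟨mapIsColimitOfPreservesOfIsColimit G a b hc⟩

variable [HasZeroMorphisms X]

/-- A morphism `G A ⟶ G B` extends `G` to the partial morphism `x : A ⇀ B` if it is given by `G` on
the domain of definition, and is zero on its complement. -/
structure IsExtension {A B : IntPreord C} (x : PMap A B) (d : G.obj A ⟶ G.obj B) : Prop where
  map_incl : G.map x.incl ≫ d = G.map x.map
  map_complement : ∀ {N : IntPreord C} (n : N ⟶ A), IsComplement x.incl n → G.map n ≫ d = 0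

variable {G}

theorem IsExtension.of_isComplement {A B N : IntPreord C} {x : PMap A B} {d : G.obj A ⟶ G.obj B}
    {n : N ⟶ A} (hn : IsComplement x.incl n) (h₁ : G.map x.incl ≫ d = G.map x.map)
    (h₂ : G.map n ≫ d = 0) : IsExtension G x d := by
  refine ⟨h₁, fun n' hn' => ?_⟩
  obtain ⟨g, rfl⟩ := exists_factor_of_isComplement hn hn'
  rw [G.map_comp, Category.assoc, h₂, comp_zero]

theorem IsExtension.of_same {A B : IntPreord C} {x y : PMap A B} (h : x.Same y)
    {d : G.obj A ⟶ G.obj B} (hd : IsExtension G x d) : IsExtension G y d := by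
  obtain ⟨N, n, hn⟩ := y.complemented
  obtain ⟨e, h₁, h₂⟩ := h
  have hx : IsComplement x.incl n :=
    isComplement_of_isPullback hn (f := 𝟙 A) (q := e.hom) (q' := 𝟙 N)
      (IsPullback.of_vert_isIso ⟨by simp [h₁]⟩) (IsPullback.of_vert_isIso ⟨by simp⟩)
  refine .of_isComplement hn ?_ (hd.map_complement n hx)
  rw [← cancel_epi (G.map e.hom), ← Category.assoc, ← G.map_comp, ← G.map_comp, h₁, h₂, hd.map_incl]

variable [PreservesFiniteCoproducts G]

theorem IsExtension.unique {A B : IntPreord C} {x : PMap A B} {d d' : G.obj A ⟶ G.obj B}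
    (h : IsExtension G x d) (h' : IsExtension G x d') : d = d' := by
  obtain ⟨N, n, hn⟩ := x.complemented
  exact (isCop_map_of_isComplement G hn).hom_ext (h.map_incl.trans h'.map_incl.symm)
    ((h.map_complement n hn).trans (h'.map_complement n hn).symm)

theorem exists_isExtension {A B : IntPreord C} (x : PMap A B) : ∃ d, IsExtension G x d := by
  obtain ⟨N, n, hn⟩ := x.complemented
  obtain ⟨d, h₁, h₂⟩ := (isCop_map_of_isComplement G hn).desc (G.map x.map) 0
  exact ⟨d, .of_isComplement hn h₁ h₂⟩

theorem isExtension_ofHom {A B : IntPreord C} (f : A ⟶ B) :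
    IsExtension G (PMap.ofHom f) (G.map f) := by
  obtain ⟨hE⟩ := empty_isInitial (C := C)
  refine .of_isComplement (isComplement_id_empty (hE.to A) hE) ?_ (map_eq_zero_of_isInitial hE _)
  change G.map (𝟙 A) ≫ G.map f = G.map f
  rw [G.map_id, Category.id_comp]

theorem IsExtension.comp {A B D : IntPreord C} {x : PMap A B} {y : PMap B D}
    {d : G.obj A ⟶ G.obj B} {e : G.obj B ⟶ G.obj D} (hd : IsExtension G x d)
    (he : IsExtension G y e) : IsExtension G (x.comp y) (d ≫ e) := by
  obtain ⟨N, n, hn⟩ := x.complemented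
  obtain ⟨M, m, hm⟩ := y.complemented
  have h₁ := isPullback_pb x.map y.incl
  have h₂ := isPullback_pb x.map m
  obtain ⟨S, i, j, s, hS, hi, hj, hs⟩ :=
    exists_isComplement_comp (isComplement_of_isPullback hm h₁ h₂) hn
  refine .of_isComplement hs ?_ ((isCop_map_of_isComplement G hS).hom_ext ?_ ?_)
  · change G.map (pbFst x.map y.incl ≫ x.incl) ≫ d ≫ e = G.map (pbSnd x.map y.incl ≫ y.map)
    rw [G.map_comp, Category.assoc, ← Category.assoc (G.map x.incl), hd.map_incl, ← Category.assoc,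
      ← G.map_comp, h₁.w, G.map_comp, Category.assoc, he.map_incl, G.map_comp]
  · rw [← Category.assoc, ← G.map_comp, hi, G.map_comp, Category.assoc,
      ← Category.assoc (G.map x.incl), hd.map_incl, ← Category.assoc, ← G.map_comp, h₂.w,
      G.map_comp, Category.assoc, he.map_complement m hm, comp_zero, comp_zero]
  · rw [← Category.assoc, ← G.map_comp, hj, ← Category.assoc, hd.map_complement n hn, zero_comp,
      comp_zero]

/-- Restricting a partial morphism to a complemented part of its domain of definition does not
change the extension, if the partial morphism is trivial on the other part. -/
theorem IsExtension.restrict (hG : ∀ {A B : IntPreord C} (f : A ⟶ B),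
      IsTrivialMor (trivialObj C) f → G.map f = 0)
    {A B A₀ N : IntPreord C} {x : PMap A B} {d : G.obj A ⟶ G.obj B} (hd : IsExtension G x d)
    {a : A₀ ⟶ x.dom} {n : N ⟶ x.dom} (hn : IsComplement a n)
    (ht : IsTrivialMor (trivialObj C) (n ≫ x.map)) (hc : IsComplemented (a ≫ x.incl)) :
    IsExtension G ⟨A₀, a ≫ x.incl, a ≫ x.map, hc⟩ d := by
  obtain ⟨M, m, hm⟩ := x.complemented
  obtain ⟨S, i, j, s, hS, hi, hj, hs⟩ := exists_isComplement_comp hn hm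
  refine .of_isComplement hs ?_ ((isCop_map_of_isComplement G hS).hom_ext ?_ ?_)
  · change G.map (a ≫ x.incl) ≫ d = G.map (a ≫ x.map)
    rw [G.map_comp, Category.assoc, hd.map_incl, G.map_comp]
  · rw [← Category.assoc, ← G.map_comp, hi, G.map_comp, Category.assoc, hd.map_incl, ← G.map_comp,
      hG _ ht, comp_zero]
  · rw [← Category.assoc, ← G.map_comp, hj, hd.map_complement m hm, comp_zero]

theorem IsExtension.eq_of_congruenceDiagram (hG : ∀ {A B : IntPreord C} (f : A ⟶ B),
      IsTrivialMor (trivialObj C) f → G.map f = 0)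
    {A B : IntPreord C} {x y : PMap A B} (h : CongruenceDiagram x y) {d e : G.obj A ⟶ G.obj B}
    (hd : IsExtension G x d) (he : IsExtension G y e) : d = e := by
  obtain ⟨A₀, N₁, N₂, a₁, a₂, n₁, n₂, h₁, h₂, hc, hi, hm, t₁, t₂⟩ := h
  have hd' := hd.restrict hG h₁ t₁ hc
  have he' := he.restrict hG h₂ t₂ (hi ▸ hc)
  simp only [← hi, ← hm] at he'
  exact hd'.unique he'

theorem exists_isExtension_paPreord {A B : PaPreord C} (f : A ⟶ B) :
    ∃ d : G.obj A.as ⟶ G.obj B.as, ∀ x : PMap A.as B.as, x.toHom = f → IsExtension G x d := by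
  obtain ⟨x, rfl⟩ := PMap.exists_toHom f
  obtain ⟨d, hd⟩ := exists_isExtension (G := G) x
  exact ⟨d, fun y hy => hd.of_same (PMap.toHom_eq_iff.1 hy.symm)⟩

variable (G)

/-- The extension of `G` to partial morphisms, by zero on the complement of the domain of
definition. -/
noncomputable def paPreordExtension : PaPreord C ⥤ X where
  obj A := G.obj A.as
  map f := (exists_isExtension_paPreord (G := G) f).choose
  map_id A := ((exists_isExtension_paPreord (G := G) (𝟙 A)).choose_spec (PMap.ofHom (𝟙 A.as))
    rfl).unique (G.map_id A.as ▸ isExtension_ofHom (𝟙 A.as))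
  map_comp {A B D} f g := by
    obtain ⟨x, rfl⟩ := PMap.exists_toHom f
    obtain ⟨y, rfl⟩ := PMap.exists_toHom g
    exact ((exists_isExtension_paPreord (G := G) _).choose_spec (x.comp y) rfl).unique
      (((exists_isExtension_paPreord (G := G) _).choose_spec x rfl).comp
        ((exists_isExtension_paPreord (G := G) _).choose_spec y rfl))

theorem isExtension_paPreordExtension {A B : PaPreord C} (x : PMap A.as B.as) :
    IsExtension G x ((paPreordExtension G).map (x.toHom : A ⟶ B)) :=
  (exists_isExtension_paPreord (G := G) _).choose_spec x rfl

variable (hG : ∀ {A B : IntPreord C} (f : A ⟶ B), IsTrivialMor (trivialObj C) f → G.map f = 0)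

/-- The extension of `G` to the stable category. -/
noncomputable def stabExtension : Stab C ⥤ X :=
  CategoryTheory.Quotient.lift _ (paPreordExtension G) fun A B f g h => by
    obtain ⟨x, y, rfl, rfl, h⟩ := h
    exact (isExtension_paPreordExtension G x).eq_of_congruenceDiagram hG h
      (isExtension_paPreordExtension G y)

theorem isExtension_stabExtension {A B : IntPreord C} (x : PMap A B) :
    IsExtension G x ((stabExtension G hG).map x.toStab) :=
  isExtension_paPreordExtension G (A := ⟨A⟩) (B := ⟨B⟩) x

theorem stabFunctor_comp_stabExtension : stabFunctor C ⋙ stabExtension G hG = G :=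
  CategoryTheory.Functor.hext (fun _ => rfl) fun A B f => by
    have := (isExtension_stabExtension G hG (PMap.ofHom f)).unique (isExtension_ofHom f)
    exact heq_of_eq this

/-- Any functor on the stable category extends its restriction to internal preorders. -/
theorem isExtension_map_toStab (H : Stab C ⥤ X) [PreservesFiniteCoproducts (stabFunctor C ⋙ H)]
    {A B : IntPreord C} (x : PMap A B) : IsExtension (stabFunctor C ⋙ H) x (H.map x.toStab) := by
  obtain ⟨N, n, hn⟩ := x.complemented
  refine .of_isComplement hn ?_ ?_
  · change H.map ((stabFunctor C).map x.incl) ≫ H.map x.toStab = H.map ((stabFunctor C).map x.map)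
    rw [← H.map_comp, x.stabFunctor_map_incl_comp_toStab]
  · change H.map ((stabFunctor C).map n) ≫ H.map x.toStab = 0
    obtain ⟨hE⟩ := empty_isInitial (C := C)
    -- `H` sends zero morphisms to zero morphisms, since it sends the zero object to an initial one
    have h₀ : (0 : (stabFunctor C).obj N ⟶ (stabFunctor C).obj B) =
        0 ≫ (stabFunctor C).map (hE.to B) := zero_comp.symm
    have h₁ : 𝟙 (H.obj ((stabFunctor C).obj (empty C))) = 0 :=
      map_eq_zero_of_isInitial (G := stabFunctor C ⋙ H) hE (𝟙 _)
    rw [← H.map_comp, x.stabFunctor_map_comp_toStab_eq_zero hn, h₀, H.map_comp,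
      ← Category.id_comp (H.map ((stabFunctor C).map (hE.to B))), h₁, zero_comp, comp_zero]

theorem eq_stabExtension (H : Stab C ⥤ X) [PreservesFiniteCoproducts (stabFunctor C ⋙ H)]
    (hH : ∀ {A B : IntPreord C} (f : A ⟶ B),
      IsTrivialMor (trivialObj C) f → (stabFunctor C ⋙ H).map f = 0) :
    H = stabExtension (stabFunctor C ⋙ H) hH :=
  CategoryTheory.Functor.hext (fun _ => rfl) fun A B f => by
    obtain ⟨x, rfl⟩ := PMap.exists_toStab (X := A.as.as) (Y := B.as.as) f
    have := (isExtension_map_toStab H x).unique (isExtension_stabExtension _ hH x)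
    exact heq_of_eq this

theorem preservesKernels_stabExtension [HasBinaryCoproducts X]
    (hpre : PreUniversalBinaryCoproducts X)
    (hker : SendsZKernelsToKernels (trivialObj C) G) : PreservesKernels (stabExtension G hG) := by
  rintro ⟨⟨L⟩⟩ ⟨⟨A⟩⟩ ⟨⟨B⟩⟩ l f hl
  obtain ⟨x, rfl⟩ := PMap.exists_toStab (X := A) (Y := B) f
  obtain ⟨N, n, hn⟩ := x.complemented
  obtain ⟨K, k₀, hk₀⟩ := exists_isZKernel x.map
  obtain ⟨S, i, j, hS⟩ := exists_isComplement_sum K N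
  obtain ⟨k, hi, hj⟩ := (isCop_of_isComplement hS).desc (k₀ ≫ x.incl) n
  have hx := isExtension_stabExtension G hG x
  refine IsKernelOf.map_of_weakKernel (stabExtension G hG)
    (x.stabFunctor_map_kernel_comp_toStab hn hk₀ hS hi hj)
    (fun {W} l h => x.exists_factor_kernel hn hk₀ hi hj (W := W.as.as) l h) ?_ hl
  have hk : (stabExtension G hG).map ((stabFunctor C).map k) = G.map k :=
    (isExtension_stabExtension G hG (PMap.ofHom k)).unique (isExtension_ofHom k)
  rw [hk]
  exact IsKernelOf.of_isCop hpre (isCop_map_of_isComplement G hn) (isCop_map_of_isComplement G hS)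
    (hker k₀ x.map hk₀) (by rw [← G.map_comp, hi, G.map_comp]) (by rw [← G.map_comp, hj])
    hx.map_incl (hx.map_complement n hn)

end Extension

/-- A torsion theory functor sends the trivial morphisms to zero morphisms: it sends the trivial
objects to objects that are both torsion and torsion-free. -/
theorem IsTorsionTheoryFunctor.map_eq_zero {A : Type u} [Category.{v} A] {T F : ObjectProperty A}
    {B : Type u'} [Category.{v'} B] [HasZeroMorphisms B] {T' F' : ObjectProperty B} {G : A ⥤ B}
    (hG : IsTorsionTheoryFunctor T F T' F' G) (h : IsTorsionTheory T' F') {X Y : A} (f : X ⟶ Y)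
    (hf : IsTrivialMor (T ⊓ F) f) : G.map f = 0 := by
  obtain ⟨W, g, g', ⟨hT, hF⟩, rfl⟩ := hf
  have h₀ : 𝟙 (G.obj W) = 0 := h.hom_eq_zero _ (hG.map_left W hT) (hG.map_right W hF)
  rw [G.map_comp, ← Category.id_comp (G.map g'), h₀, zero_comp, comp_zero]

end PreordStab

theorem mainTheorem9
    {C : Type u} [Category.{v} C] [PreordStab.TauPretopos C]
    {X : Type u'} [Category.{v'} X] [HasZeroObject X] [HasZeroMorphisms X]
    [HasFiniteCoproducts X]
    (hdisj : BinaryCoproductsDisjoint X)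
    (hpre : PreordStab.PreUniversalBinaryCoproducts X)
    (T F : ObjectProperty X) (hTF : PreordStab.IsTorsionTheory T F)
    (G : PreordStab.IntPreord C ⥤ X)
    (hcop : PreservesFiniteCoproducts G)
    (htt : PreordStab.IsTorsionTheoryFunctor (PreordStab.IntPreord.eqRel C)
      (PreordStab.IntPreord.parOrd C) T F G)
    (hker : PreordStab.SendsZKernelsToKernels (PreordStab.IntPreord.trivialObj C) G) :
    ∃ Gbar : PreordStab.Stab C ⥤ X,
      (PreordStab.stabFunctor C ⋙ Gbar = G ∧
        ∀ H : PreordStab.Stab C ⥤ X, PreordStab.stabFunctor C ⋙ H = G → H = Gbar) ∧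
      PreordStab.PreservesKernels Gbar := by
  have hG := fun {A B : PreordStab.IntPreord C} (f : A ⟶ B) => htt.map_eq_zero hTF f
  refine ⟨PreordStab.stabExtension G hG, ⟨PreordStab.stabFunctor_comp_stabExtension G hG, ?_⟩,
    PreordStab.preservesKernels_stabExtension G hG hpre hker⟩
  rintro H rfl
  exact PreordStab.eq_stabExtension H hG
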